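/- Let $n\ge 1$ and $N\ge n+2$ be integers. Let ${\rm LC}_c(\mathbb R^n)$ be the set of functions $f=e^{-\psi}:\mathbb R^n\to[0,\infty)$, where $\psi:\mathbb R^n\to(-\infty,+\infty]$ is convex, lower semicontinuous, not identically $+\infty$, and coercive ($\psi(x)\to+\infty$ as $\|x\|\to\infty$); put $-\log f=\psi$. **Mean width.** For $f\in{\rm LC}_c(\mathbb R^n)$ let $h_f(x)=\sup_{y\in\mathbb R^n}(\langle x,y\rangle+\log f(y))$ and $w_0(f)=\frac2n\int_{\mathbb R^n}h_f\,d\gamma_n\in(-\infty,+\infty]$, where $\gamma_n$ is the standard Gaussian probability measure on $\mathbb R^n$. **Inner log-linearizations.** Given finitely many (at least one) points $(x_1,y_1),\dots,(x_k,y_k)$ in the epigraph $\{(x,t)\in\mathbb R^n\times\mathbb R:\psi(x)\le t\}$ of $\psi=-\log f$, the corresponding inner linearization of $\psi$ is $p(x)=\min\{\sum_i\lambda_iy_i:\lambda_i\ge0,\ \sum_i\lambda_i=1,\ \sum_i\lambda_ix_i=x\}$, with $p(x)=+\infty$ if $x\notin{\rm conv}\{x_1,\dots,x_k\}$. A break point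 of $p$ is a point $x$ such that $(x,y)$ is an extreme point of the epigraph of $p$ for some $y\in\mathbb R$. Let $\mathscr P_N(f)$ be the set of all $q=e^{-p}$ with $p$ an inner linearization of $-\log f$ having at most $N$ break points, and $$G_N(f)=\sup_{q\in\mathscr P_N(f)}w_0(q)\in(-\infty,+\infty].$$ **Hypo-symmetrization.** For a unit vector $u$, let $R_u$ be the reflection about $u^\perp$ and let $(\tau_uf)(x)=\sup_{y+z=x}\sqrt{f(2y)\,f(R_u(2z))}$ be the Minkowski symmetral of $f$. A sequence $f_j=e^{-\psi_j}$ hypo-converges to $g=e^{-\varphi}$ if for every $x$ one has $\varphi(x)\le\liminf_j\psi_j(x_j)$ for all sequences $x_j\to x$, and $\varphi(x)=\lim_j\psi_j(x_j)$ for at least one sequence $x_j\to x$. A hypo-symmetrization $f_{\rm sym}$ of $f$ is a function in ${\rm LC}_c(\mathbb R^n)$ that is invariant under all linear isometries of $\mathbb R^n$ and is the hypo-limit, as $m\to\infty$, of $\tau_{u_m}\cdots\tau_{u_1}f$ for some sequence of unit vectors $(u_i)$. **Theorem.** Every $f\in{\rm LC}_c(\mathbb R^n)$ has a hypo-symmetrization,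 and for every hypo-symmetrization $f_{\rm sym}$ of $f$, $$G_N(f)\ \ge\ G_N(f_{\rm sym}).$$ -/

import Mathlib

open MeasureTheory ProbabilityTheory Filter Topology
open scoped ENNReal InnerProductSpace

namespace HypoSym

/-- `ℝⁿ` with the Euclidean inner product. -/
abbrev E (n : ℕ) : Type := EuclideanSpace ℝ (Fin n)

/-! ### Convex functions with values in `[-∞, ∞]` and log-concave functions -/

/-- The epigraph `{(x, t) ∈ ℝⁿ × ℝ : ψ x ≤ t}`. -/
def epi {n : ℕ} (ψ : E n → EReal) : Set (E n × ℝ) :=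
  {p | ψ p.1 ≤ (p.2 : EReal)}

/-- `Conv_c(ℝⁿ)`: convex, coercive, proper, lower semicontinuous functions.
An extended-real valued function is convex when its epigraph is convex. -/
structure IsConvC {n : ℕ} (ψ : E n → EReal) : Prop where
  convex : Convex ℝ (epi ψ)
  coercive : Tendsto ψ (Bornology.cobounded (E n)) (𝓝 ⊤)
  proper : ∃ x, ψ x < ⊤
  lsc : LowerSemicontinuous ψ

/-- `LC_c(ℝⁿ)`: functions `f : ℝⁿ → [0, ∞)` of the form `f = e^{-ψ}` with `ψ ∈ Conv_c(ℝⁿ)`. -/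
def IsLCc {n : ℕ} (f : E n → ℝ≥0∞) : Prop :=
  (∀ x, f x ≠ ∞) ∧ ∃ ψ : E n → EReal, IsConvC ψ ∧ ∀ x, f x = EReal.exp (-ψ x)

/-- The base function `-log f` (with `-log 0 = +∞`), so that `f = e^{-base f}`. -/
noncomputable def base {n : ℕ} (f : E n → ℝ≥0∞) : E n → EReal :=
  fun x => -ENNReal.log (f x)

/-! ### Mean width -/

/-- The Legendre-Fenchel conjugate `(ℒψ)(x) = sup_y (⟨x, y⟩ - ψ(y))`. -/
noncomputable def conjugate {n : ℕ} (ψ : E n → EReal) : E n → EReal :=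
  fun x => ⨆ y : E n, ((⟪x, y⟫_ℝ : ℝ) : EReal) - ψ y

/-- The support function `h_f = ℒ(-log f)`. -/
noncomputable def supportFun {n : ℕ} (f : E n → ℝ≥0∞) : E n → EReal :=
  conjugate (base f)

/-- The integral of an extended-real valued function, as the integral of the positive part minus
the integral of the negative part. -/
noncomputable def erealIntegral {α : Type*} [MeasurableSpace α] (μ : Measure α)
    (h : α → EReal) : EReal :=
  ((∫⁻ x, (h x).toENNReal ∂μ : ℝ≥0∞) : EReal) - ((∫⁻ x, (-h x).toENNReal ∂μ : ℝ≥0∞) : EReal)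

/-- The Gaussian mean width `w₀(f) = (2/n) ∫ h_f dγ_n`, with `γ_n` the standard Gaussian
probability measure on `ℝⁿ`. -/
noncomputable def meanWidth {n : ℕ} (f : E n → ℝ≥0∞) : EReal :=
  ((2 / (n : ℝ) : ℝ) : EReal) * erealIntegral (stdGaussian (E n)) (supportFun f)

/-! ### Inner (log-)linearizations -/

/-- The inner linearization determined by the points `X i = (xᵢ, yᵢ)`: its value at `x` is the
minimum of `∑ λᵢ yᵢ` over all convex weights `λ` with `∑ λᵢ xᵢ = x`, and `+∞` if there are none. -/
noncomputable def innerLin {n k : ℕ} (X : Fin k → E n × ℝ) : E n → EReal :=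
  fun x => ⨅ (l : Fin k → ℝ) (_ : l ∈ stdSimplex ℝ (Fin k)) (_ : ∑ i, l i • (X i).1 = x),
    ((∑ i, l i * (X i).2 : ℝ) : EReal)

/-- The break points of `p`: the points `x` over which the epigraph of `p` has an extreme point. -/
def breakPoints {n : ℕ} (p : E n → EReal) : Set (E n) :=
  {x | ∃ y : ℝ, (x, y) ∈ (epi p).extremePoints ℝ}

/-- `𝒞_N(ψ)`: inner linearizations, determined by a finite nonempty family of points of the
epigraph of `ψ`, with at most `N` break points. -/
def innerLinearizations {n : ℕ} (N : ℕ) (ψ : E n → EReal) : Set (E n → EReal) :=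
  {p | (∃ (k : ℕ) (X : Fin k → E n × ℝ), 0 < k ∧ (∀ i, X i ∈ epi ψ) ∧ p = innerLin X) ∧
    (breakPoints p).encard ≤ N}

/-- `𝒫_N(f) = {e^{-p} : p ∈ 𝒞_N(-log f)}`: inner log-linearizations with at most `N` break
points. -/
def innerLogLinearizations {n : ℕ} (N : ℕ) (f : E n → ℝ≥0∞) : Set (E n → ℝ≥0∞) :=
  {q | ∃ p ∈ innerLinearizations N (base f), q = fun x => EReal.exp (-p x)}

/-- `G_N(f) = sup {w₀(q) : q ∈ 𝒫_N(f)}`, a supremum in `[-∞, ∞]`. -/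
noncomputable def G {n : ℕ} (N : ℕ) (f : E n → ℝ≥0∞) : EReal :=
  ⨆ q ∈ innerLogLinearizations N f, meanWidth q

/-! ### Minkowski symmetrization and hypo-symmetrization -/

/-- The Asplund sum `(f ⋆ g)(x) = sup_{y+z=x} f(y) g(z)`. -/
noncomputable def asplund {n : ℕ} (f g : E n → ℝ≥0∞) : E n → ℝ≥0∞ :=
  fun x => ⨆ (y : E n) (z : E n) (_ : y + z = x), f y * g z

/-- The homothety `(λ · f)(x) = f(x / λ) ^ λ`. -/
noncomputable def homothety {n : ℕ} (l : ℝ) (f : E n → ℝ≥0∞) : E n → ℝ≥0∞ :=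
  fun x => f (l⁻¹ • x) ^ l

/-- The reflection `R_u f` of `f` about the hyperplane `u^⊥`. -/
noncomputable def reflectFun {n : ℕ} (u : E n) (f : E n → ℝ≥0∞) : E n → ℝ≥0∞ :=
  fun x => f ((Submodule.span ℝ {u})ᗮ.reflection x)

/-- The Minkowski symmetral `τ_u f = ½ · f ⋆ ½ · R_u f`. -/
noncomputable def minkSym {n : ℕ} (u : E n) (f : E n → ℝ≥0∞) : E n → ℝ≥0∞ :=
  asplund (homothety (1 / 2) f) (homothety (1 / 2) (reflectFun u f))

/-- Successive Minkowski symmetrizations of `f` in the directions `u 0, …, u (m - 1)`. -/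
noncomputable def iterSym {n : ℕ} (u : ℕ → E n) (f : E n → ℝ≥0∞) : ℕ → (E n → ℝ≥0∞)
  | 0 => f
  | m + 1 => minkSym (u m) (iterSym u f m)

/-- Epi-convergence of a sequence of extended-real valued functions. -/
def EpiConverges {n : ℕ} (ψ : ℕ → E n → EReal) (φ : E n → EReal) : Prop :=
  ∀ x : E n,
    (∀ s : ℕ → E n, Tendsto s atTop (𝓝 x) → φ x ≤ liminf (fun j => ψ j (s j)) atTop) ∧
    ∃ s : ℕ → E n, Tendsto s atTop (𝓝 x) ∧ Tendsto (fun j => ψ j (s j)) atTop (𝓝 (φ x))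

/-- Hypo-convergence `e^{-ψ_j} → e^{-φ}`: epi-convergence of the base functions. -/
def HypoConverges {n : ℕ} (f : ℕ → E n → ℝ≥0∞) (g : E n → ℝ≥0∞) : Prop :=
  EpiConverges (fun j => base (f j)) (base g)

/-- `g` is the hypo-symmetrization `f_sym` of `f`: the rotation-invariant member of `LC_c(ℝⁿ)`
which is the hypo-limit of a sequence of successive Minkowski symmetrizations of `f`. -/
structure IsHypoSymmetrization {n : ℕ} (f g : E n → ℝ≥0∞) : Prop where
  mem : IsLCc g
  rotation_invariant : ∀ (T : E n ≃ₗᵢ[ℝ] E n) (x : E n), g (T x) = g x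
  limit : ∃ u : ℕ → E n, (∀ i, ‖u i‖ = 1) ∧ HypoConverges (iterSym u f) g

end HypoSym

/-!
The strict epigraph of the base function of `τ_u f` is the Minkowski symmetral of the strict
epigraph of the base function of `f`, and its support function is the average of the support
function and its reflection.

Monotonicity: the mean width of an inner linearization of the base function of `τ_u f` depends only
on the at most `N` extreme points of its epigraph. Each of them is, up to a small error, the
midpoint of a point `a` and a reflected point `b` of the epigraph for `f`, so the support function
of the linearization is at most the average of the one of the points `a` and the reflection of the
one of the points `b`. The Gaussian measure is reflection invariant, hence one of these two families
has at least the same mean width. Finally, points of the epigraph of a hypo-limit are limits of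
points of the epigraphs of the symmetrals, and the width depends continuously on the points.

Existence: choose directions whose reflections recurrently come close to every rotation of any given
vector. The averages of the support function then converge, uniformly on compact balls inside its
domain, to a radial function, while the domains of the support functions of the symmetrals shrink to
the largest centred ball inside the original domain. The conjugate of the limit is the base function
of the hypo-limit.
-/

namespace HypoSym

/-! ### Support functions of subsets of `V × ℝ` -/

section Support

variable {V : Type*} [NormedAddCommGroup V] [InnerProductSpace ℝ V]

/-- The linear functional `(z, t) ↦ ⟨y, z⟩ - t` on `V × ℝ`; over the epigraph of `ψ` its supremum
is the conjugate of `ψ` at `y`. -/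
noncomputable def aff (y : V) : V × ℝ →L[ℝ] ℝ :=
  (innerSL ℝ y).comp (ContinuousLinearMap.fst ℝ V ℝ) - ContinuousLinearMap.snd ℝ V ℝ

/-- The domain of the support function of `K ⊆ V × ℝ`. -/
def suppDom (K : Set (V × ℝ)) : Set V := {y | BddAbove (aff y '' K)}

/-- The support function `y ↦ sup_{(z, t) ∈ K} (⟨y, z⟩ - t)` of `K ⊆ V × ℝ`, with junk value `0`
outside `suppDom K`. -/
noncomputable def supp (K : Set (V × ℝ)) (y : V) : ℝ := sSup (aff y '' K)

variable {K : Set (V × ℝ)} {y : V}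

lemma aff_apply (y : V) (p : V × ℝ) : aff y p = ⟪y, p.1⟫_ℝ - p.2 := rfl

lemma aff_convexComb (x y : V) (p : V × ℝ) {s t : ℝ} (hst : s + t = 1) :
    aff (s • x + t • y) p = s * aff x p + t * aff y p := by
  simp only [aff_apply, inner_add_left, real_inner_smul_left]
  linear_combination p.2 * hst

lemma mem_suppDom_iff : y ∈ suppDom K ↔ ∃ c, ∀ p ∈ K, aff y p ≤ c := by
  simp only [suppDom, Set.mem_ofPred_eq, bddAbove_def, Set.forall_mem_image]

lemma isLUB_supp (hK : K.Nonempty) (hy : y ∈ suppDom K) : IsLUB (aff y '' K) (supp K y) :=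
  isLUB_csSup (hK.image _) hy

lemma aff_le_supp (hy : y ∈ suppDom K) {p : V × ℝ} (hp : p ∈ K) : aff y p ≤ supp K y :=
  le_csSup hy (Set.mem_image_of_mem _ hp)

lemma convex_suppDom (K : Set (V × ℝ)) : Convex ℝ (suppDom K) := by
  intro x hx y hy s t hs ht hst
  refine mem_suppDom_iff.2 ⟨s * supp K x + t * supp K y, fun p hp => ?_⟩
  rw [aff_convexComb x y p hst]
  gcongr <;> exact aff_le_supp ‹_› hp

lemma convexOn_supp (hK : K.Nonempty) : ConvexOn ℝ (suppDom K) (supp K) := by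
  refine ⟨convex_suppDom K, fun x hx y hy s t hs ht hst => csSup_le (hK.image _) ?_⟩
  rintro _ ⟨p, hp, rfl⟩
  rw [aff_convexComb x y p hst, smul_eq_mul, smul_eq_mul]
  gcongr <;> exact aff_le_supp ‹_› hp

end Support

/-! ### Minkowski symmetrals of subsets of `V × ℝ` -/

section Symmetral

variable {V : Type*} [NormedAddCommGroup V] [InnerProductSpace ℝ V]

/-- The reflection about the hyperplane `u^⊥`. -/
noncomputable abbrev refl (u : V) : V ≃ₗᵢ[ℝ] V := (Submodule.span ℝ {u})ᗮ.reflection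

/-- The Minkowski symmetral of a subset of `V × ℝ` with respect to `u^⊥ × ℝ`. -/
def symSet (u : V) (K : Set (V × ℝ)) : Set (V × ℝ) :=
  Set.image2 (fun a b => (1 / 2 : ℝ) • (a + (refl u b.1, b.2))) K K

/-- Successive Minkowski symmetrals of `K` in the directions `u 0, …, u (m - 1)`. -/
def symIter (u : ℕ → V) (K : Set (V × ℝ)) : ℕ → Set (V × ℝ)
  | 0 => K
  | m + 1 => symSet (u m) (symIter u K m)

lemma refl_refl (u x : V) : refl u (refl u x) = x := Submodule.reflection_reflection _ x

lemma inner_refl_left (u x y : V) : ⟪refl u x, y⟫_ℝ = ⟪x, refl u y⟫_ℝ := by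
  rw [← (refl u).inner_map_map x (refl u y), refl_refl]

lemma aff_symPoint (u y : V) (a b : V × ℝ) :
    aff y ((1 / 2 : ℝ) • (a + (refl u b.1, b.2))) = (aff y a + aff (refl u y) b) / 2 := by
  simp only [map_smul, map_add, aff_apply, inner_refl_left, smul_eq_mul]
  ring

variable {K : Set (V × ℝ)}

lemma convex_symSet (u : V) (hK : Convex ℝ K) : Convex ℝ (symSet u K) := by
  rintro _ ⟨a, ha, b, hb, rfl⟩ _ ⟨c, hc, d, hd, rfl⟩ s t hs ht hst
  refine ⟨_, hK ha hc hs ht hst, _, hK hb hd hs ht hst, Prod.ext ?_ ?_⟩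
  · simp only [Prod.smul_fst, Prod.fst_add, map_add, map_smul]
    module
  · simp only [Prod.smul_snd, Prod.snd_add]
    module

lemma mem_upperBounds_symSet {u y : V} {c : ℝ} :
    c ∈ upperBounds (aff y '' symSet u K) ↔
      ∀ p ∈ K, ∀ q ∈ K, aff y p + aff (refl u y) q ≤ 2 * c := by
  simp only [symSet, mem_upperBounds, Set.forall_mem_image, Set.forall_mem_image2, aff_symPoint,
    div_le_iff₀' (zero_lt_two' ℝ)]

lemma isLUB_symSet {u y : V} {a b : ℝ} (ha : IsLUB (aff y '' K) a)
    (hb : IsLUB (aff (refl u y) '' K) b) : IsLUB (aff y '' symSet u K) ((a + b) / 2) := by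
  refine ⟨mem_upperBounds_symSet.2 fun p hp q hq => ?_, fun c hc => ?_⟩
  · linarith [ha.1 ⟨p, hp, rfl⟩, hb.1 ⟨q, hq, rfl⟩]
  · rw [mem_upperBounds_symSet] at hc
    have le_sub : ∀ q ∈ K, a ≤ 2 * c - aff (refl u y) q := fun q hq =>
      ha.2 (Set.forall_mem_image.2 fun p hp => by linarith [hc p hp q hq])
    have : b ≤ 2 * c - a := hb.2 (Set.forall_mem_image.2 fun q hq => by linarith [le_sub q hq])
    linarith

lemma mem_suppDom_symSet {u y : V} (hK : K.Nonempty) :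
    y ∈ suppDom (symSet u K) ↔ y ∈ suppDom K ∧ refl u y ∈ suppDom K := by
  refine ⟨fun ⟨c, hc⟩ => ?_,
    fun ⟨h, h'⟩ => (isLUB_symSet (isLUB_supp hK h) (isLUB_supp hK h')).bddAbove⟩
  rw [mem_upperBounds_symSet] at hc
  obtain ⟨r, hr⟩ := hK
  exact ⟨mem_suppDom_iff.2 ⟨2 * c - aff (refl u y) r, fun p hp => by linarith [hc p hp r hr]⟩,
    mem_suppDom_iff.2 ⟨2 * c - aff y r, fun p hp => by linarith [hc r hr p hp]⟩⟩

variable {u : ℕ → V}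

lemma nonempty_symIter (hK : K.Nonempty) (m : ℕ) : (symIter u K m).Nonempty := by
  induction m with
  | zero => exact hK
  | succ m ih => exact ih.image2 ih

lemma convex_symIter (hK : Convex ℝ K) (m : ℕ) : Convex ℝ (symIter u K m) := by
  induction m with
  | zero => exact hK
  | succ m ih => exact convex_symSet _ ih

lemma antitone_suppDom_symIter (hK : K.Nonempty) : Antitone fun m => suppDom (symIter u K m) :=
  antitone_nat_of_succ_le fun m _ hy => ((mem_suppDom_symSet (nonempty_symIter hK m)).1 hy).1

lemma refl_mem_suppDom {m : ℕ} {y : V} (hK : K.Nonempty)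
    (hy : y ∈ suppDom (symIter u K (m + 1))) : refl (u m) y ∈ suppDom K :=
  antitone_suppDom_symIter hK (Nat.zero_le m)
    ((mem_suppDom_symSet (nonempty_symIter hK m)).1 hy).2

end Symmetral

/-! ### Strict epigraphs of Minkowski symmetrals -/

section StrictEpi

variable {n : ℕ}

/-- The strict epigraph `{(x, t) : ψ x < t}`. Unlike epigraphs, strict epigraphs turn infima over
decompositions `y + z = x` into Minkowski sums even when the infima are not attained. -/
def strictEpi (ψ : E n → EReal) : Set (E n × ℝ) := {p | ψ p.1 < (p.2 : EReal)}

lemma strictEpi_subset_epi (ψ : E n → EReal) : strictEpi ψ ⊆ epi ψ :=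
  fun p (hp : ψ p.1 < p.2) => hp.le

lemma convex_strictEpi {ψ : E n → EReal} (hψ : Convex ℝ (epi ψ)) : Convex ℝ (strictEpi ψ) := by
  intro p hp q hq a b ha hb hab
  obtain ⟨s, hps, hs⟩ := EReal.lt_iff_exists_real_btwn.1 hp
  obtain ⟨t, hqt, ht⟩ := EReal.lt_iff_exists_real_btwn.1 hq
  have hcomb : ψ (a • p.1 + b • q.1) ≤ ((a * s + b * t : ℝ) : EReal) :=
    hψ (x := (p.1, s)) hps.le (y := (q.1, t)) hqt.le ha hb hab
  refine hcomb.trans_lt (EReal.coe_lt_coe_iff.2 ?_)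
  rw [EReal.coe_lt_coe_iff] at hs ht
  have : 0 < a * (p.2 - s) + b * (q.2 - t) :=
    convex_Ioi (0 : ℝ) (sub_pos.2 hs) (sub_pos.2 ht) ha hb hab
  change a * s + b * t < a * p.2 + b * q.2
  linarith

lemma coe_lt_add_iff {a b : EReal} {c : ℝ} :
    (c : EReal) < a + b ↔ ∃ s r : ℝ, (s : EReal) < a ∧ (r : EReal) < b ∧ s + r = c := by
  constructor
  · intro h
    obtain ⟨s, hs, hsa⟩ := EReal.lt_iff_exists_real_btwn.1 (EReal.sub_lt_of_lt_add h)
    have hc : (c : EReal) < s + b := (EReal.sub_lt_iff (by simp) (by simp)).1 hs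
    exact ⟨s, c - s, hsa, mod_cast EReal.sub_lt_of_lt_add' hc, by ring⟩
  · rintro ⟨s, r, hs, hr, rfl⟩
    exact mod_cast EReal.add_lt_add hs hr

lemma coe_lt_half_mul_iff {a : EReal} {s : ℝ} :
    (s : EReal) < ((1 / 2 : ℝ) : EReal) * a ↔ ((2 * s : ℝ) : EReal) < a := by
  induction a with
  | bot => simp [EReal.coe_mul_bot_of_pos]
  | coe x =>
    rw [← EReal.coe_mul, EReal.coe_lt_coe_iff, EReal.coe_lt_coe_iff]
    constructor <;> intro h <;> linarith
  | top => simp [EReal.coe_mul_top_of_pos, -EReal.coe_mul, EReal.coe_lt_top]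

lemma log_minkSym (u : E n) (f : E n → ℝ≥0∞) (x : E n) :
    ENNReal.log (minkSym u f x) = ⨆ (y : E n) (z : E n) (_ : y + z = x),
      ((1 / 2 : ℝ) : EReal) * ENNReal.log (f ((2 : ℝ) • y)) +
        ((1 / 2 : ℝ) : EReal) * ENNReal.log (f (refl u ((2 : ℝ) • z))) := by
  simp only [minkSym, asplund, homothety, reflectFun, ← ENNReal.logOrderIso_apply,
    OrderIso.map_iSup]
  simp only [ENNReal.logOrderIso_apply, ENNReal.log_mul_add, ENNReal.log_rpow, one_div, inv_inv]

lemma mem_strictEpi_base {f : E n → ℝ≥0∞} {x : E n} {t : ℝ} :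
    (x, t) ∈ strictEpi (base f) ↔ ((-t : ℝ) : EReal) < ENNReal.log (f x) :=
  EReal.neg_lt_comm

lemma strictEpi_base_minkSym (u : E n) (f : E n → ℝ≥0∞) :
    strictEpi (base (minkSym u f)) = symSet u (strictEpi (base f)) := by
  ext ⟨x, t⟩
  rw [mem_strictEpi_base, log_minkSym]
  simp only [lt_iSup_iff, coe_lt_add_iff, coe_lt_half_mul_iff]
  constructor
  · rintro ⟨y, z, rfl, s, r, hs, hr, hsr⟩
    refine ⟨((2 : ℝ) • y, -(2 * s)), mem_strictEpi_base.2 (by rwa [neg_neg]),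
      (refl u ((2 : ℝ) • z), -(2 * r)), mem_strictEpi_base.2 (by rwa [neg_neg]), Prod.ext ?_ ?_⟩
    · simp
    · simp only [Prod.smul_snd, Prod.snd_add, smul_eq_mul]
      linarith
  · rintro ⟨a, ha, b, hb, hab⟩
    obtain ⟨rfl, rfl⟩ := Prod.ext_iff.1 hab
    refine ⟨(1 / 2 : ℝ) • a.1, (1 / 2 : ℝ) • refl u b.1, by simp, -a.2 / 2, -b.2 / 2, ?_, ?_, ?_⟩
    · simpa [smul_smul, mul_div_cancel₀] using mem_strictEpi_base.1 ha
    · simpa [smul_smul, mul_div_cancel₀, refl_refl] using mem_strictEpi_base.1 hb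
    · simp only [Prod.smul_snd, Prod.snd_add, smul_eq_mul]
      ring

lemma strictEpi_base_iterSym (u : ℕ → E n) (f : E n → ℝ≥0∞) (m : ℕ) :
    strictEpi (base (iterSym u f m)) = symIter u (strictEpi (base f)) m := by
  induction m with
  | zero => rfl
  | succ m ih => rw [iterSym, strictEpi_base_minkSym, ih, symIter]

end StrictEpi

/-! ### Inner linearizations -/

section UpHull

variable {V : Type*} [NormedAddCommGroup V] [InnerProductSpace ℝ V]

/-- The points of `V × ℝ` lying on or above the convex hull of `S`. -/
def upHull (S : Set (V × ℝ)) : Set (V × ℝ) :=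
  {p | ∃ q ∈ convexHull ℝ S, q.1 = p.1 ∧ q.2 ≤ p.2}

variable {S : Set (V × ℝ)}

lemma convexHull_subset_upHull (S : Set (V × ℝ)) : convexHull ℝ S ⊆ upHull S :=
  fun q hq => ⟨q, hq, rfl, le_rfl⟩

lemma aff_le_of_mem_upHull {y : V} {c : ℝ} (hS : ∀ q ∈ S, aff y q ≤ c) {p : V × ℝ}
    (hp : p ∈ upHull S) : aff y p ≤ c := by
  obtain ⟨q, hq, hfst, hsnd⟩ := hp
  have hqc : aff y q ≤ c :=
    convexHull_min hS (convex_halfSpace_le (aff y).isLinear c) hq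
  simp only [aff_apply, hfst] at hqc ⊢
  linarith

lemma eq_of_mem_extremePoints_upHull {p q : V × ℝ} (hp : p ∈ (upHull S).extremePoints ℝ)
    (hq : q ∈ upHull S) (hfst : q.1 = p.1) (hsnd : q.2 ≤ p.2) : q = p := by
  obtain ⟨r, hr, hrfst, hrsnd⟩ := hq
  have hseg : p ∈ openSegment ℝ q (p.1, 2 * p.2 - q.2) := by
    refine ⟨1 / 2, 1 / 2, by norm_num, by norm_num, by norm_num, Prod.ext ?_ ?_⟩
    · rw [Prod.fst_add, Prod.smul_fst, Prod.smul_fst, hfst]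
      module
    · simp only [Prod.snd_add, Prod.smul_snd, smul_eq_mul]
      ring
  have habove : (p.1, 2 * p.2 - q.2) ∈ upHull S :=
    ⟨r, hr, hrfst.trans hfst, by linarith⟩
  exact hp.2 ⟨r, hr, hrfst, hrsnd⟩ habove hseg

lemma injOn_fst_extremePoints_upHull : Set.InjOn Prod.fst ((upHull S).extremePoints ℝ) := by
  intro p hp q hq h
  rcases le_total p.2 q.2 with hle | hle
  · exact eq_of_mem_extremePoints_upHull hq hp.1 h hle
  · exact (eq_of_mem_extremePoints_upHull hp hq.1 h.symm hle).symm

lemma extremePoints_upHull_subset : (upHull S).extremePoints ℝ ⊆ S := by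
  intro p hp
  obtain ⟨q, hq, hfst, hsnd⟩ := hp.1
  obtain rfl := eq_of_mem_extremePoints_upHull hp (convexHull_subset_upHull S hq) hfst hsnd
  exact extremePoints_convexHull_subset
    (inter_extremePoints_subset_extremePoints_of_subset (convexHull_subset_upHull S) ⟨hq, hp⟩)

lemma toExposed_aff_upHull (y : V) :
    (aff y).toExposed (upHull S) = (aff y).toExposed (convexHull ℝ S) := by
  ext p
  constructor
  · rintro ⟨⟨q, hq, hfst, hsnd⟩, hmax⟩
    have hqp : q = p := by
      have := hmax q (convexHull_subset_upHull S hq)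
      simp only [aff_apply, hfst] at this
      exact Prod.ext hfst (by linarith)
    exact ⟨hqp ▸ hq, fun r hr => hmax r (convexHull_subset_upHull S hr)⟩
  · rintro ⟨hp, hmax⟩
    exact ⟨convexHull_subset_upHull S hp, fun r hr =>
      aff_le_of_mem_upHull (fun q hq => hmax q (subset_convexHull ℝ S hq)) hr⟩

lemma exists_mem_extremePoints_upHull_forall_aff_le (hS : S.Finite) (hne : S.Nonempty) (y : V) :
    ∃ p ∈ (upHull S).extremePoints ℝ, ∀ q ∈ S, aff y q ≤ aff y p := by
  have hcompact : IsCompact (convexHull ℝ S) := hS.isCompact_convexHull ℝ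
  have hface : IsCompact ((aff y).toExposed (convexHull ℝ S)) :=
    ContinuousLinearMap.toExposed.isExposed.isCompact hcompact
  obtain ⟨m, hm, hmax⟩ := hcompact.exists_isMaxOn hne.convexHull (aff y).continuous.continuousOn
  obtain ⟨p, hp⟩ := hface.extremePoints_nonempty ⟨m, hm, hmax⟩
  refine ⟨p, ?_, fun q hq => hp.1.2 q (subset_convexHull ℝ S hq)⟩
  rw [← toExposed_aff_upHull] at hp
  exact ContinuousLinearMap.toExposed.isExposed.isExtreme.extremePoints_subset_extremePoints hp

lemma suppDom_eq_univ_of_finite (hS : S.Finite) : suppDom S = Set.univ :=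
  Set.eq_univ_of_forall fun _ => (hS.image _).bddAbove

lemma aff_le_supp_of_finite (hS : S.Finite) {p : V × ℝ} (hp : p ∈ S) (y : V) :
    aff y p ≤ supp S y :=
  aff_le_supp (suppDom_eq_univ_of_finite hS ▸ Set.mem_univ y) hp

lemma exists_aff_eq_supp_of_finite (hS : S.Finite) (hne : S.Nonempty) (y : V) :
    ∃ p ∈ S, aff y p = supp S y :=
  (hne.image _).csSup_mem (hS.image _)

lemma supp_le (hne : S.Nonempty) {y : V} {c : ℝ} (h : ∀ p ∈ S, aff y p ≤ c) : supp S y ≤ c :=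
  csSup_le (hne.image _) (Set.forall_mem_image.2 h)

lemma nonempty_extremePoints_upHull (hS : S.Finite) (hne : S.Nonempty) :
    ((upHull S).extremePoints ℝ).Nonempty :=
  let ⟨p, hp, _⟩ := exists_mem_extremePoints_upHull_forall_aff_le hS hne 0
  ⟨p, hp⟩

lemma supp_extremePoints_upHull (hS : S.Finite) (hne : S.Nonempty) :
    supp ((upHull S).extremePoints ℝ) = supp S := by
  funext y
  obtain ⟨p, hp, hmax⟩ := exists_mem_extremePoints_upHull_forall_aff_le hS hne y
  have hext := extremePoints_upHull_subset (S := S)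
  exact le_antisymm (supp_le ⟨p, hp⟩ fun q hq => aff_le_supp_of_finite hS (hext hq) y)
    ((supp_le hne hmax).trans (aff_le_supp_of_finite (hS.subset hext) hp y))

end UpHull

section InnerLin

variable {n k : ℕ}

lemma mem_convexHull_range_iff {W ι : Type*} [AddCommGroup W] [Module ℝ W] [Fintype ι]
    {X : ι → W} {p : W} :
    p ∈ convexHull ℝ (Set.range X) ↔ ∃ l ∈ stdSimplex ℝ ι, ∑ i, l i • X i = p := by
  classical
  have himage : convexHull ℝ (Set.range X) =
      Fintype.linearCombination ℝ X '' stdSimplex ℝ ι := by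
    rw [← convexHull_basis_eq_stdSimplex, LinearMap.image_convexHull, ← Set.range_comp]
    congr 2
    funext i
    simp [Fintype.linearCombination_apply]
  simp only [himage, Set.mem_image, Fintype.linearCombination_apply]

lemma innerLin_le_of_mem_convexHull {X : Fin k → E n × ℝ} {q : E n × ℝ}
    (hq : q ∈ convexHull ℝ (Set.range X)) : innerLin X q.1 ≤ q.2 := by
  obtain ⟨l, hl, rfl⟩ := mem_convexHull_range_iff.1 hq
  exact iInf₂_le_of_le l hl (iInf_le_of_le (by simp [Prod.fst_sum]) (by simp [Prod.snd_sum]))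

lemma exists_mem_convexHull_le_innerLin {X : Fin k → E n × ℝ} {x : E n} (hx : innerLin X x < ⊤) :
    ∃ q ∈ convexHull ℝ (Set.range X), q.1 = x ∧ (q.2 : EReal) ≤ innerLin X x := by
  have mem_hull : ∀ l ∈ stdSimplex ℝ (Fin k), ∑ i, l i • (X i).1 = x →
      (x, ∑ i, l i * (X i).2) ∈ convexHull ℝ (Set.range X) := fun l hl hlx =>
    mem_convexHull_range_iff.2 ⟨l, hl, Prod.ext (by simpa [Prod.fst_sum]) (by simp [Prod.snd_sum])⟩
  have hcompact : IsCompact (convexHull ℝ (Set.range X) ∩ Prod.fst ⁻¹' {x}) :=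
    ((Set.finite_range X).isCompact_convexHull ℝ).inter_right
      (isClosed_singleton.preimage continuous_fst)
  simp only [innerLin, iInf_lt_iff] at hx
  obtain ⟨l, hl, hlx, -⟩ := hx
  obtain ⟨q, ⟨hq, hqx⟩, hmin⟩ :=
    hcompact.exists_isMinOn ⟨_, mem_hull l hl hlx, rfl⟩ continuous_snd.continuousOn
  refine ⟨q, hq, hqx, le_iInf₂ fun w hw => le_iInf fun hwx => EReal.coe_le_coe_iff.2 ?_⟩
  exact hmin ⟨mem_hull w hw hwx, rfl⟩

lemma epi_innerLin (X : Fin k → E n × ℝ) : epi (innerLin X) = upHull (Set.range X) := by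
  ext p
  constructor
  · intro (hp : innerLin X p.1 ≤ p.2)
    obtain ⟨q, hq, hqp, hle⟩ := exists_mem_convexHull_le_innerLin (hp.trans_lt (EReal.coe_lt_top _))
    exact ⟨q, hq, hqp, EReal.coe_le_coe_iff.1 (hle.trans hp)⟩
  · rintro ⟨q, hq, hqp, hle⟩
    change innerLin X p.1 ≤ p.2
    exact hqp ▸ (innerLin_le_of_mem_convexHull hq).trans (EReal.coe_le_coe_iff.2 hle)

lemma breakPoints_innerLin (X : Fin k → E n × ℝ) :
    breakPoints (innerLin X) = Prod.fst '' (upHull (Set.range X)).extremePoints ℝ := by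
  ext x
  simp [breakPoints, epi_innerLin]

lemma encard_breakPoints_innerLin (X : Fin k → E n × ℝ) :
    (breakPoints (innerLin X)).encard = ((upHull (Set.range X)).extremePoints ℝ).encard := by
  rw [breakPoints_innerLin, injOn_fst_extremePoints_upHull.encard_image]

lemma conjugate_innerLin [NeZero k] (X : Fin k → E n × ℝ) (y : E n) :
    conjugate (innerLin X) y = (supp (Set.range X) y : EReal) := by
  have hfin : (Set.range X).Finite := Set.finite_range X
  apply le_antisymm
  · refine iSup_le fun z => ?_
    rcases eq_or_ne (innerLin X z) ⊤ with htop | htop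
    · simp [htop]
    obtain ⟨q, hq, rfl, hle⟩ := exists_mem_convexHull_le_innerLin htop.lt_top
    refine (EReal.sub_le_sub le_rfl hle).trans (EReal.coe_le_coe_iff.2 ?_)
    exact aff_le_of_mem_upHull (fun p hp => aff_le_supp_of_finite hfin hp y)
      (convexHull_subset_upHull _ hq)
  · obtain ⟨p, hp, hpy⟩ := exists_aff_eq_supp_of_finite hfin (Set.range_nonempty X) y
    rw [← hpy, aff_apply, EReal.coe_sub]
    exact le_iSup_of_le p.1
      (EReal.sub_le_sub le_rfl (innerLin_le_of_mem_convexHull (subset_convexHull ℝ _ hp)))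

end InnerLin

/-! ### Gaussian width -/

section GaussWidth

variable {V : Type*} [NormedAddCommGroup V] [InnerProductSpace ℝ V] [FiniteDimensional ℝ V]
  [MeasurableSpace V]

/-- The Gaussian integral of the support function of a set of points of `V × ℝ`. -/
noncomputable def gaussWidth (S : Set (V × ℝ)) : ℝ := ∫ y, supp S y ∂stdGaussian V

/-- All nonempty subsets of `K` with at most `N` points have Gaussian width at most `c`. -/
def WidthLE (N : ℕ) (K : Set (V × ℝ)) (c : ℝ) : Prop :=
  ∀ S ⊆ K, S.Nonempty → S.encard ≤ N → gaussWidth S ≤ c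

lemma WidthLE.mono {N : ℕ} {K L : Set (V × ℝ)} {c : ℝ} (h : WidthLE N L c) (hKL : K ⊆ L) :
    WidthLE N K c :=
  fun S hS => h S (hS.trans hKL)

variable [BorelSpace V] {S : Set (V × ℝ)}

lemma integrable_aff (p : V × ℝ) : Integrable (fun y => aff y p) (stdGaussian V) :=
  (IsGaussian.integrable_id.inner_const p.1).sub (integrable_const p.2)

lemma integrable_supp (hS : S.Finite) (hne : S.Nonempty) :
    Integrable (supp S) (stdGaussian V) := by
  have hcont : Continuous (supp S) := by
    have hconvex := convexOn_supp hne
    rw [suppDom_eq_univ_of_finite hS] at hconvex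
    exact continuousOn_univ.1 (hconvex.continuousOn isOpen_univ)
  refine Integrable.mono' (integrable_finsetSum hS.toFinset fun p _ => (integrable_aff p).abs)
    hcont.aestronglyMeasurable (ae_of_all _ fun y => ?_)
  obtain ⟨p, hp, hpy⟩ := exists_aff_eq_supp_of_finite hS hne y
  rw [← hpy, Real.norm_eq_abs]
  exact Finset.single_le_sum (f := fun p => |aff y p|) (fun _ _ => abs_nonneg _)
    (hS.mem_toFinset.2 hp)

lemma measurePreserving_refl (u : V) :
    MeasurePreserving (refl u).toMeasurableEquiv (stdGaussian V) (stdGaussian V) :=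
  ⟨(refl u).toMeasurableEquiv.measurable, stdGaussian_map (refl u)⟩

lemma gaussWidth_le_of_supp_le {A B : Set (V × ℝ)} (u : V) (hS : S.Finite) (hS' : S.Nonempty)
    (hA : A.Finite) (hA' : A.Nonempty) (hB : B.Finite) (hB' : B.Nonempty)
    (h : ∀ y, supp S y ≤ (supp A y + supp B (refl u y)) / 2) :
    gaussWidth S ≤ (gaussWidth A + gaussWidth B) / 2 := by
  have hAint := integrable_supp hA hA'
  have hBint : Integrable (fun y => supp B (refl u y)) (stdGaussian V) :=
    (measurePreserving_refl u).integrable_comp_of_integrable (integrable_supp hB hB')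
  calc gaussWidth S
      ≤ ∫ y, (supp A y + supp B (refl u y)) / 2 ∂stdGaussian V :=
        integral_mono (integrable_supp hS hS') ((hAint.add hBint).div_const 2) h
    _ = (gaussWidth A + ∫ y, supp B (refl u y) ∂stdGaussian V) / 2 := by
        rw [integral_div, integral_add hAint hBint, gaussWidth]
    _ = (gaussWidth A + gaussWidth B) / 2 := by
        congr 2
        exact (measurePreserving_refl u).integral_comp' (supp B)

lemma gaussWidth_le_image_add (hS : S.Finite) (hne : S.Nonempty) {φ : V × ℝ → V × ℝ} {δ : ℝ}
    (hφ : ∀ p ∈ S, ‖φ p - p‖ ≤ δ) :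
    gaussWidth S ≤ gaussWidth (φ '' S) + δ * (∫ y, ‖y‖ ∂stdGaussian V + 1) := by
  have hnorm : Integrable (fun y : V => ‖y‖) (stdGaussian V) := IsGaussian.integrable_id.norm
  have herr : Integrable (fun y : V => δ * (‖y‖ + 1)) (stdGaussian V) :=
    (hnorm.add (integrable_const 1)).const_mul δ
  have himage := integrable_supp (hS.image φ) (hne.image φ)
  have supp_le_add : ∀ y, supp S y ≤ supp (φ '' S) y + δ * (‖y‖ + 1) := fun y =>
    supp_le hne fun p hp => by
      have hle := aff_le_supp_of_finite (hS.image φ) (Set.mem_image_of_mem φ hp) y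
      obtain ⟨hfst, hsnd⟩ := norm_prod_le_iff.1 (hφ p hp)
      have hinner : -(‖y‖ * δ) ≤ ⟪y, (φ p).1 - p.1⟫_ℝ := by
        have := (abs_real_inner_le_norm y ((φ p).1 - p.1)).trans
          (mul_le_mul_of_nonneg_left hfst (norm_nonneg y))
        exact (abs_le.1 this).1
      have hheight : (φ p).2 - p.2 ≤ δ := (le_abs_self _).trans hsnd
      rw [inner_sub_right] at hinner
      rw [aff_apply] at hle ⊢
      linarith
  calc gaussWidth S ≤ ∫ y, (supp (φ '' S) y + δ * (‖y‖ + 1)) ∂stdGaussian V :=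
        integral_mono (integrable_supp hS hne) (himage.add herr) supp_le_add
    _ = _ := by
        rw [integral_add himage herr, integral_const_mul, integral_add hnorm (integrable_const 1),
          gaussWidth]
        simp

namespace WidthLE

variable {N : ℕ} {K : Set (V × ℝ)} {c : ℝ}

protected lemma symSet (h : WidthLE N K c) (u : V) : WidthLE N (symSet u K) c := by
  intro S hSK hne hN
  have hfin : S.Finite := Set.finite_of_encard_le_coe hN
  choose! a ha b hb hab using hSK
  have width_image : ∀ φ : V × ℝ → V × ℝ, (∀ p ∈ S, φ p ∈ K) → gaussWidth (φ '' S) ≤ c :=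
    fun φ hφ => h _ (Set.image_subset_iff.2 hφ) (hne.image φ) ((Set.encard_image_le φ S).trans hN)
  have hsupp : ∀ y, supp S y ≤ (supp (a '' S) y + supp (b '' S) (refl u y)) / 2 := fun y =>
    supp_le hne fun p hp => by
      rw [← hab hp, aff_symPoint]
      linarith [aff_le_supp_of_finite (hfin.image a) (Set.mem_image_of_mem a hp) y,
        aff_le_supp_of_finite (hfin.image b) (Set.mem_image_of_mem b hp) (refl u y)]
  linarith [width_image a @ha, width_image b @hb, gaussWidth_le_of_supp_le u hfin hne
    (hfin.image a) (hne.image a) (hfin.image b) (hne.image b) hsupp]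

protected lemma symIter (h : WidthLE N K c) (u : ℕ → V) (m : ℕ) : WidthLE N (symIter u K m) c := by
  induction m with
  | zero => exact h
  | succ m ih => exact ih.symSet (u m)

lemma of_eventually {ι : Type*} {l : Filter ι} [l.NeBot] {L : ι → Set (V × ℝ)}
    (hL : ∀ j, WidthLE N (L j) c)
    (hK : ∀ p ∈ K, ∀ δ > 0, ∀ᶠ j in l, ∃ q ∈ L j, ‖q - p‖ ≤ δ) : WidthLE N K c := by
  intro S hSK hne hN
  have hfin : S.Finite := Set.finite_of_encard_le_coe hN
  have hC : 0 < ∫ y, ‖y‖ ∂stdGaussian V + 1 :=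
    add_pos_of_nonneg_of_pos (integral_nonneg fun y => norm_nonneg y) one_pos
  refine le_of_forall_pos_le_add fun ε hε => ?_
  have hδ := div_pos hε hC
  obtain ⟨j, hj⟩ := ((eventually_all_finite hfin).2 fun p hp => hK p (hSK hp) _ hδ).exists
  choose! φ hφL hφ using hj
  have himage := hL j (φ '' S) (Set.image_subset_iff.2 hφL) (hne.image φ)
    ((Set.encard_image_le φ S).trans hN)
  have hle := gaussWidth_le_image_add hfin hne hφ
  rw [div_mul_cancel₀ _ hC.ne'] at hle
  linarith

end WidthLE

end GaussWidth

section MeanWidth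

variable {n : ℕ}

lemma erealIntegral_coe {α : Type*} [MeasurableSpace α] {μ : Measure α} {h : α → ℝ}
    (hh : Integrable h μ) :
    erealIntegral μ (fun x => (h x : EReal)) = ((∫ x, h x ∂μ : ℝ) : EReal) := by
  have hneg : ∫⁻ x, ENNReal.ofReal (-h x) ∂μ ≠ ∞ := hh.neg.lintegral_lt_top.ne
  simp only [erealIntegral, ← EReal.coe_neg, EReal.real_coe_toENNReal]
  rw [integral_eq_lintegral_pos_part_sub_lintegral_neg_part hh, EReal.coe_sub,
    EReal.coe_ennreal_toReal hh.lintegral_lt_top.ne, EReal.coe_ennreal_toReal hneg]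

lemma base_exp_neg (ψ : E n → EReal) : base (fun x => EReal.exp (-ψ x)) = ψ := by
  funext x
  simp [base]

lemma meanWidth_exp_neg_innerLin {k : ℕ} [NeZero k] (X : Fin k → E n × ℝ) :
    meanWidth (fun x => EReal.exp (-innerLin X x)) =
      ((2 / n * gaussWidth (Set.range X) : ℝ) : EReal) := by
  have hsupp : supportFun (fun x => EReal.exp (-innerLin X x)) =
      fun y => (supp (Set.range X) y : EReal) := by
    funext y
    rw [supportFun, base_exp_neg, conjugate_innerLin]
  rw [meanWidth, hsupp,
    erealIntegral_coe (integrable_supp (Set.finite_range X) (Set.range_nonempty X)),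
    EReal.coe_mul, gaussWidth]

lemma G_le_coe_iff (hn : 1 ≤ n) {N : ℕ} {f : E n → ℝ≥0∞} {c : ℝ} :
    G N f ≤ ((2 / n * c : ℝ) : EReal) ↔ WidthLE N (epi (base f)) c := by
  have hn' : (0 : ℝ) < 2 / n := by positivity
  have meanWidth_le_iff : ∀ {k : ℕ} [NeZero k] (X : Fin k → E n × ℝ),
      meanWidth (fun x => EReal.exp (-innerLin X x)) ≤ ((2 / n * c : ℝ) : EReal) ↔
        gaussWidth (Set.range X) ≤ c := fun X => by
    rw [meanWidth_exp_neg_innerLin, EReal.coe_le_coe_iff, mul_le_mul_iff_right₀ hn']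
  constructor
  · intro h S hS hne hN
    obtain ⟨k, X, -, rfl⟩ := (Set.finite_of_encard_le_coe hN).fin_param
    have : NeZero k := ⟨by rintro rfl; simp at hne⟩
    refine (meanWidth_le_iff X).1 (le_trans ?_ h)
    refine le_iSup₂_of_le _ ⟨innerLin X, ⟨⟨k, X, NeZero.pos k, ?_, rfl⟩, ?_⟩, rfl⟩ le_rfl
    · exact Set.range_subset_iff.1 hS
    · rw [encard_breakPoints_innerLin]
      exact (Set.encard_le_encard extremePoints_upHull_subset).trans hN
  · refine fun h => iSup₂_le ?_
    rintro _ ⟨_, ⟨⟨k, X, hk, hX, rfl⟩, hN⟩, rfl⟩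
    have : NeZero k := ⟨hk.ne'⟩
    rw [encard_breakPoints_innerLin] at hN
    have hfin := Set.finite_range X
    have hne := Set.range_nonempty X
    rw [meanWidth_le_iff, gaussWidth, ← supp_extremePoints_upHull hfin hne]
    exact h _ (extremePoints_upHull_subset.trans (Set.range_subset_iff.2 hX))
      (nonempty_extremePoints_upHull hfin hne) hN

lemma eventually_exists_mem_strictEpi {ψ : ℕ → E n → EReal} {φ : E n → EReal}
    (h : EpiConverges ψ φ) {p : E n × ℝ} (hp : p ∈ epi φ) {δ : ℝ} (hδ : 0 < δ) :
    ∀ᶠ j in atTop, ∃ q ∈ strictEpi (ψ j), ‖q - p‖ ≤ δ := by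
  obtain ⟨s, hs, hψs⟩ := (h p.1).2
  have hlt : φ p.1 < ((p.2 + δ : ℝ) : EReal) :=
    lt_of_le_of_lt hp (EReal.coe_lt_coe_iff.2 (by linarith))
  filter_upwards [(tendsto_iff_norm_sub_tendsto_zero.1 hs).eventually_le_const hδ,
    hψs.eventually_lt_const hlt] with j hj hj'
  exact ⟨(s j, p.2 + δ), hj', norm_prod_le_iff.2 ⟨hj, by simp [abs_of_pos hδ]⟩⟩

theorem G_le_of_hypoConverges_iterSym (hn : 1 ≤ n) (N : ℕ) {f g : E n → ℝ≥0∞} {u : ℕ → E n}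
    (h : HypoConverges (iterSym u f) g) : G N g ≤ G N f := by
  refine EReal.le_of_forall_lt_iff_le.1 fun c hc => ?_
  obtain ⟨d, rfl⟩ : ∃ d : ℝ, c = 2 / n * d := ⟨n / 2 * c, by field_simp⟩
  have hwidth : WidthLE N (strictEpi (base f)) d :=
    ((G_le_coe_iff hn).1 hc.le).mono (strictEpi_subset_epi _)
  refine (G_le_coe_iff hn).2 (.of_eventually (l := atTop) (hwidth.symIter u) fun p hp δ hδ => ?_)
  simpa only [strictEpi_base_iterSym] using eventually_exists_mem_strictEpi h hp hδ

end MeanWidth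

/-! ### Averaging along reflections -/

section Directions

variable {V : Type*} [NormedAddCommGroup V] [InnerProductSpace ℝ V]

lemma refl_apply_of_norm_eq_one {v : V} (hv : ‖v‖ = 1) (x : V) :
    refl v x = x - (2 * ⟪v, x⟫_ℝ) • v := by
  rw [refl, Submodule.reflection_orthogonal_apply, Submodule.reflection_singleton_apply]
  simp only [hv, one_pow, div_one, RCLike.ofReal_one]
  module

lemma refl_normalize_sub {x y : V} (hxy : ‖x‖ = ‖y‖) (hne : x ≠ y) :
    refl (NormedSpace.normalize (x - y)) x = y := by
  have hd : ‖x - y‖⁻¹ ≠ 0 := inv_ne_zero (norm_ne_zero_iff.2 (sub_ne_zero.2 hne))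
  simp only [refl, NormedSpace.normalize, Submodule.span_singleton_smul_eq (IsUnit.mk0 _ hd)]
  exact Submodule.reflection_sub hxy

lemma norm_refl_sub_refl_le {v w : V} (hv : ‖v‖ = 1) (hw : ‖w‖ = 1) (x : V) :
    ‖refl v x - refl w x‖ ≤ 4 * ‖v - w‖ * ‖x‖ := by
  have split : refl v x - refl w x = (2 * ⟪w - v, x⟫_ℝ) • w + (2 * ⟪v, x⟫_ℝ) • (w - v) := by
    rw [refl_apply_of_norm_eq_one hv, refl_apply_of_norm_eq_one hw, inner_sub_left]
    module
  calc ‖refl v x - refl w x‖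
      ≤ 2 * |⟪w - v, x⟫_ℝ| * ‖w‖ + 2 * |⟪v, x⟫_ℝ| * ‖w - v‖ := by
        rw [split]
        refine (norm_add_le _ _).trans_eq ?_
        simp only [norm_smul, norm_mul, Real.norm_eq_abs, abs_two]
    _ ≤ 2 * (‖w - v‖ * ‖x‖) * ‖w‖ + 2 * (‖v‖ * ‖x‖) * ‖w - v‖ := by
        gcongr <;> exact abs_real_inner_le_norm _ _
    _ = 4 * ‖v - w‖ * ‖x‖ := by rw [hv, hw, norm_sub_rev w v]; ring

/-- A sequence of unit vectors which contains, arbitrarily late, blocks forming a `δ`-net of the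
unit sphere, of a length depending only on `δ`. -/
structure IsRecurrentlyDense (u : ℕ → V) : Prop where
  norm_eq_one : ∀ i, ‖u i‖ = 1
  exists_block : ∀ δ > 0, ∃ L : ℕ, ∀ m₀, ∃ m ≥ m₀, ∀ w : V, ‖w‖ = 1 →
    ∃ i < L, ‖u (m + i) - w‖ ≤ δ

-- Run through longer and longer initial segments of a dense sequence.
lemma exists_isRecurrentlyDense (V : Type*) [NormedAddCommGroup V] [InnerProductSpace ℝ V]
    [FiniteDimensional ℝ V] [Nontrivial V] : ∃ u : ℕ → V, IsRecurrentlyDense u := by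
  have : Nonempty (Metric.sphere (0 : V) 1) :=
    (NormedSpace.sphere_nonempty.2 zero_le_one).to_subtype
  let v := TopologicalSpace.denseSeq (Metric.sphere (0 : V) 1)
  refine ⟨fun m => v (m - 2 ^ Nat.log 2 m), fun i => by simp, fun δ hδ => ?_⟩
  obtain ⟨t, ht⟩ := isCompact_univ.elim_finite_subcover (fun i => Metric.ball (v i) δ)
    (fun i => Metric.isOpen_ball) fun w _ => Set.mem_iUnion.2
      ((TopologicalSpace.denseRange_denseSeq _).exists_dist_lt w hδ)
  obtain ⟨L, hL⟩ := t.bddAbove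
  refine ⟨L + 1, fun m₀ => ⟨2 ^ (m₀ + (L + 1)), ?_, fun w hw => ?_⟩⟩
  · exact (Nat.le_add_right _ _).trans Nat.lt_two_pow_self.le
  · obtain ⟨i, hit, hi⟩ := Set.mem_iUnion₂.1 (ht (Set.mem_univ ⟨w, by simpa using hw⟩))
    have hiL : i ≤ L := hL hit
    have hlt : i < 2 ^ (m₀ + (L + 1)) :=
      lt_of_le_of_lt (by omega) (Nat.lt_two_pow_self (n := m₀ + (L + 1)))
    have hlog : Nat.log 2 (2 ^ (m₀ + (L + 1)) + i) = m₀ + (L + 1) :=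
      Nat.log_eq_of_pow_le_of_lt_pow (by omega) (by rw [pow_succ]; omega)
    refine ⟨i, by omega, ?_⟩
    rw [hlog, Nat.add_sub_cancel_left, ← dist_eq_norm, dist_comm]
    exact hi.le

lemma IsRecurrentlyDense.exists_norm_refl_sub_le {u : ℕ → V} (hu : IsRecurrentlyDense u)
    {ρ η : ℝ} (hη : 0 < η) (hρ : 0 ≤ ρ) :
    ∃ L : ℕ, ∀ m₀, ∃ m ≥ m₀, ∀ x y : V, ‖x‖ = ‖y‖ → ‖x‖ ≤ ρ → x ≠ y →
      ∃ i < L, ‖refl (u (m + i)) x - y‖ ≤ η := by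
  obtain ⟨L, hL⟩ := hu.exists_block (η / (4 * (ρ + 1))) (by positivity)
  refine ⟨L, fun m₀ => ?_⟩
  obtain ⟨m, hm, hblock⟩ := hL m₀
  refine ⟨m, hm, fun x y hxy hx hne => ?_⟩
  have hw := NormedSpace.norm_normalize_eq_one_iff.2 (sub_ne_zero.2 hne)
  obtain ⟨i, hi, hclose⟩ := hblock _ hw
  refine ⟨i, hi, ?_⟩
  calc ‖refl (u (m + i)) x - y‖
      ≤ 4 * ‖u (m + i) - NormedSpace.normalize (x - y)‖ * ‖x‖ := by
        simpa only [refl_normalize_sub hxy hne] using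
          norm_refl_sub_refl_le (hu.norm_eq_one (m + i)) hw x
    _ ≤ 4 * (η / (4 * (ρ + 1))) * (ρ + 1) := by gcongr; linarith
    _ = η := by field_simp

end Directions

section Averages

variable {V : Type*} [NormedAddCommGroup V] [InnerProductSpace ℝ V]

/-- The successive averages of `a` over the reflections in the directions `u 0, …, u (m - 1)`; they
describe the support functions of successive Minkowski symmetrals. -/
noncomputable def avgSeq (u : ℕ → V) (a : V → ℝ) : ℕ → V → ℝ
  | 0 => a
  | m + 1 => fun y => (avgSeq u a m y + avgSeq u a m (refl (u m) y)) / 2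

/-- The oscillation of `g` on each sphere about `0` of radius at most `ρ` is at most `C`. -/
def SphericalOscLE (g : V → ℝ) (ρ C : ℝ) : Prop :=
  ∀ x y, ‖x‖ = ‖y‖ → ‖x‖ ≤ ρ → g x - g y ≤ C

variable {u : ℕ → V} {a : V → ℝ} {ρ r : ℝ} {k m : ℕ} {x : V}

lemma avgSeq_mem {s : Set ℝ} (hs : Convex ℝ s) (hkm : k ≤ m)
    (h : ∀ y, ‖y‖ = r → avgSeq u a k y ∈ s) : ∀ y, ‖y‖ = r → avgSeq u a m y ∈ s := by
  induction m, hkm using Nat.le_induction with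
  | base => exact h
  | succ m _ ih =>
    intro y hy
    convert hs (ih y hy) (ih (refl (u m) y) (by rwa [LinearIsometryEquiv.norm_map]))
      (one_half_pos (α := ℝ)).le one_half_pos.le (add_halves 1) using 1
    simp only [avgSeq, smul_eq_mul]
    ring

lemma avgSeq_zero_apply (m : ℕ) : avgSeq u a m 0 = a 0 :=
  avgSeq_mem (convex_singleton (a 0)) m.zero_le (fun y hy => by rw [norm_eq_zero.1 hy]; rfl) 0
    norm_zero

lemma avgSeq_sub_le_of_norm_sub_le {δ e : ℝ}
    (h : ∀ x y, ‖x‖ ≤ ρ → ‖y‖ ≤ ρ → ‖x - y‖ ≤ δ → a x - a y ≤ e) (m : ℕ) :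
    ∀ x y, ‖x‖ ≤ ρ → ‖y‖ ≤ ρ → ‖x - y‖ ≤ δ → avgSeq u a m x - avgSeq u a m y ≤ e := by
  induction m with
  | zero => exact h
  | succ m ih =>
    intro x y hx hy hxy
    have h_refl := ih (refl (u m) x) (refl (u m) y) (by rwa [LinearIsometryEquiv.norm_map])
      (by rwa [LinearIsometryEquiv.norm_map]) (by rwa [← map_sub, LinearIsometryEquiv.norm_map])
    simp only [avgSeq]
    linarith [ih x y hx hy hxy]

lemma avgSeq_add_le {M : ℝ} (h : ∀ y, ‖y‖ = r → avgSeq u a m y ≤ M) (L : ℕ) (hx : ‖x‖ = r) :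
    avgSeq u a (m + L) x ≤ (1 - (1 / 2) ^ L) * M + (1 / 2) ^ L * avgSeq u a m x := by
  induction L with
  | zero => simp
  | succ L ih =>
    have h_refl : avgSeq u a (m + L) (refl (u (m + L)) x) ≤ M :=
      avgSeq_mem (convex_Iic M) (Nat.le_add_right m L) h _ (by rwa [LinearIsometryEquiv.norm_map])
    rw [← add_assoc]
    simp only [avgSeq, pow_succ]
    linarith

-- Each reflection used between steps `m` and `m + L` contributes with weight at least `2⁻ᴸ`.
lemma avgSeq_add_le_refl {M : ℝ} (h : ∀ y, ‖y‖ = r → avgSeq u a m y ≤ M) {L i : ℕ} (hi : i < L)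
    (hx : ‖x‖ = r) :
    avgSeq u a (m + L) x ≤
      (1 - (1 / 2) ^ L) * M + (1 / 2) ^ L * avgSeq u a m (refl (u (m + i)) x) := by
  obtain ⟨j, rfl⟩ : ∃ j, L = i + 1 + j := ⟨L - (i + 1), by omega⟩
  have le_M : ∀ {k}, m ≤ k → ∀ y, ‖y‖ = r → avgSeq u a k y ≤ M := fun hk =>
    avgSeq_mem (convex_Iic M) hk h
  have h_refl := avgSeq_add_le h i (x := refl (u (m + i)) x) (by rwa [LinearIsometryEquiv.norm_map])
  have h_step : avgSeq u a (m + (i + 1)) x ≤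
      (M + avgSeq u a (m + i) (refl (u (m + i)) x)) / 2 := by
    rw [← add_assoc]
    simp only [avgSeq]
    linarith [le_M (Nat.le_add_right m i) x hx]
  rw [← add_assoc]
  calc avgSeq u a (m + (i + 1) + j) x
      ≤ (1 - (1 / 2) ^ j) * M + (1 / 2) ^ j * avgSeq u a (m + (i + 1)) x :=
        avgSeq_add_le (le_M (Nat.le_add_right m (i + 1))) j hx
    _ ≤ (1 - (1 / 2) ^ j) * M + (1 / 2) ^ j * ((M + ((1 - (1 / 2) ^ i) * M +
          (1 / 2) ^ i * avgSeq u a m (refl (u (m + i)) x))) / 2) := by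
        gcongr
        linarith
    _ = _ := by rw [pow_add, pow_succ]; ring

lemma SphericalOscLE.avgSeq_of_forall_sub_le {C : ℝ} (hkm : k ≤ m)
    (h : ∀ x y, ‖x‖ = ‖y‖ → ‖x‖ ≤ ρ → avgSeq u a m x - avgSeq u a k y ≤ C) :
    SphericalOscLE (avgSeq u a m) ρ C := fun x y hxy hx =>
  sub_le_comm.1 <| avgSeq_mem (convex_Ici (avgSeq u a m x - C)) hkm
    (fun z hz => sub_le_comm.1 (h x z hz.symm hx)) y hxy.symm

lemma SphericalOscLE.avgSeq_sub_le {C : ℝ} (h : SphericalOscLE (avgSeq u a k) ρ C) (hkm : k ≤ m)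
    (x y : V) (hxy : ‖x‖ = ‖y‖) (hx : ‖x‖ ≤ ρ) : avgSeq u a m x - avgSeq u a k y ≤ C :=
  sub_le_iff_le_add'.2 <| avgSeq_mem (convex_Iic (avgSeq u a k y + C)) hkm
    (fun z hz => sub_le_iff_le_add'.1 (h z y (hz.trans hxy) (hz.trans_le hx))) x rfl

lemma SphericalOscLE.avgSeq_mono {C : ℝ} (h : SphericalOscLE (avgSeq u a k) ρ C) (hkm : k ≤ m) :
    SphericalOscLE (avgSeq u a m) ρ C :=
  .avgSeq_of_forall_sub_le hkm (h.avgSeq_sub_le hkm)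

lemma SphericalOscLE.abs_avgSeq_sub_le {C : ℝ} (h : SphericalOscLE (avgSeq u a k) ρ C)
    (hkm : k ≤ m) (hx : ‖x‖ ≤ ρ) : |avgSeq u a m x - avgSeq u a k x| ≤ C := by
  have lower : avgSeq u a k x - C ≤ avgSeq u a m x :=
    avgSeq_mem (convex_Ici _) hkm (fun z hz => sub_le_comm.1 (h x z hz.symm hx)) x rfl
  exact abs_le.2 ⟨by linarith, h.avgSeq_sub_le hkm x x rfl hx⟩

lemma SphericalOscLE.exists_avgSeq_contract (hu : IsRecurrentlyDense u) {δ e : ℝ} (hρ : 0 ≤ ρ)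
    (hδ : 0 < δ) (h : ∀ x y, ‖x‖ ≤ ρ → ‖y‖ ≤ ρ → ‖x - y‖ ≤ δ → a x - a y ≤ e) :
    ∃ q : ℝ, 0 < q ∧ q ≤ 1 ∧ ∀ k C, SphericalOscLE (avgSeq u a k) ρ C →
      ∃ m, SphericalOscLE (avgSeq u a m) ρ ((1 - q) * C + q * e) := by
  obtain ⟨L, hL⟩ := hu.exists_norm_refl_sub_le hδ hρ
  have hq : (0 : ℝ) < (1 / 2) ^ L := by positivity
  refine ⟨(1 / 2) ^ L, hq, pow_le_one₀ (by norm_num) (by norm_num), fun k C hC => ?_⟩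
  obtain ⟨m, hm, hnear⟩ := hL k
  refine ⟨m + L, .avgSeq_of_forall_sub_le (Nat.le_add_right m L) fun x z hxz hx => ?_⟩
  have le_add_C : ∀ w, ‖w‖ = ‖x‖ → avgSeq u a m w ≤ avgSeq u a m z + C := fun w hw => by
    linarith [hC.avgSeq_mono hm w z (hw.trans hxz) (hw.trans_le hx)]
  by_cases hne : x = z
  · have he : 0 ≤ e := by simpa using h 0 0 (by simpa) (by simpa) (by simpa using hδ.le)
    subst hne
    linarith [avgSeq_add_le le_add_C L rfl, mul_nonneg hq.le he]
  · obtain ⟨i, hi, hclose⟩ := hnear x z hxz hx hne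
    have h_mod : avgSeq u a m (refl (u (m + i)) x) - avgSeq u a m z ≤ e :=
      avgSeq_sub_le_of_norm_sub_le h m _ z (by rwa [LinearIsometryEquiv.norm_map])
        (hxz.symm.trans_le hx) hclose
    linarith [avgSeq_add_le_refl le_add_C hi rfl, mul_le_mul_of_nonneg_left h_mod hq.le]

lemma SphericalOscLE.exists_avgSeq_pow {q e B : ℝ}
    (hB : SphericalOscLE a ρ (e + B))
    (hstep : ∀ k C, SphericalOscLE (avgSeq u a k) ρ C →
      ∃ m, SphericalOscLE (avgSeq u a m) ρ ((1 - q) * C + q * e)) (j : ℕ) :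
    ∃ m, SphericalOscLE (avgSeq u a m) ρ (e + (1 - q) ^ j * B) := by
  induction j with
  | zero => exact ⟨0, by rwa [pow_zero, one_mul]⟩
  | succ j ih =>
    obtain ⟨k, hk⟩ := ih
    obtain ⟨m, hm⟩ := hstep k _ hk
    refine ⟨m, ?_⟩
    convert hm using 1
    ring

lemma eventually_sphericalOscLE_avgSeq [FiniteDimensional ℝ V] (hu : IsRecurrentlyDense u)
    (hρ : 0 ≤ ρ) (ha : ContinuousOn a (Metric.closedBall 0 ρ)) {ε : ℝ} (hε : 0 < ε) :
    ∀ᶠ m in atTop, SphericalOscLE (avgSeq u a m) ρ ε := by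
  have hcpt : IsCompact (Metric.closedBall (0 : V) ρ) := isCompact_closedBall _ _
  obtain ⟨δ, hδ, hmod⟩ := Metric.uniformContinuousOn_iff_le.1
    (hcpt.uniformContinuousOn_of_continuous ha) (ε / 2) (half_pos hε)
  obtain ⟨q, hq0, hq1, hstep⟩ := SphericalOscLE.exists_avgSeq_contract hu (e := ε / 2) hρ hδ
    fun x y hx hy hxy => (le_abs_self _).trans
      (hmod x (by simpa using hx) y (by simpa using hy) (by rwa [dist_eq_norm]))
  obtain ⟨B, hB⟩ := (hcpt.image_of_continuousOn ha).isBounded.exists_norm_le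
  have abs_le_B : ∀ x : V, ‖x‖ ≤ ρ → |a x| ≤ B := fun x hx => hB _ ⟨x, by simpa using hx, rfl⟩
  have osc_a : SphericalOscLE a ρ (ε / 2 + 2 * B) := fun x y hxy hx => by
    linarith [abs_le.1 (abs_le_B x hx), abs_le.1 (abs_le_B y (hxy ▸ hx))]
  have hlim : Tendsto (fun j : ℕ => (1 - q) ^ j * (2 * B)) atTop (𝓝 0) := by
    simpa using (tendsto_pow_atTop_nhds_zero_of_lt_one (sub_nonneg.2 hq1)
      (sub_lt_self 1 hq0)).mul_const (2 * B)
  obtain ⟨j, hj⟩ := (hlim.eventually_lt_const (half_pos hε)).exists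
  obtain ⟨k, hk⟩ := SphericalOscLE.exists_avgSeq_pow osc_a hstep j
  filter_upwards [eventually_ge_atTop k] with m hm x y hxy hx
  linarith [hk.avgSeq_mono hm x y hxy hx]

/-- The pointwise limit of the averages of `a`; it exists at `x` when `a` is continuous on the
closed ball of radius `‖x‖` and the directions are recurrently dense. -/
noncomputable def avgLimit (u : ℕ → V) (a : V → ℝ) (x : V) : ℝ :=
  limUnder atTop fun m => avgSeq u a m x

lemma avgLimit_zero : avgLimit u a 0 = a 0 := by
  simp only [avgLimit, avgSeq_zero_apply]
  exact tendsto_const_nhds.limUnder_eq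

variable [FiniteDimensional ℝ V]

lemma tendsto_avgSeq_avgLimit (hu : IsRecurrentlyDense u)
    (ha : ContinuousOn a (Metric.closedBall 0 ‖x‖)) :
    Tendsto (fun m => avgSeq u a m x) atTop (𝓝 (avgLimit u a x)) := by
  have cauchy : CauchySeq fun m => avgSeq u a m x := Metric.cauchySeq_iff'.2 fun ε hε => by
    obtain ⟨k, hk⟩ :=
      (eventually_sphericalOscLE_avgSeq hu (norm_nonneg x) ha (half_pos hε)).exists
    exact ⟨k, fun m hm => (hk.abs_avgSeq_sub_le hm le_rfl).trans_lt (half_lt_self hε)⟩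
  exact tendsto_nhds_limUnder (cauchySeq_tendsto_of_complete cauchy)

lemma eventually_abs_avgLimit_sub_le (hu : IsRecurrentlyDense u) (hρ : 0 ≤ ρ)
    (ha : ContinuousOn a (Metric.closedBall 0 ρ)) {ε : ℝ} (hε : 0 < ε) :
    ∀ᶠ m in atTop, ∀ x, ‖x‖ ≤ ρ → |avgLimit u a x - avgSeq u a m x| ≤ ε := by
  filter_upwards [eventually_sphericalOscLE_avgSeq hu hρ ha hε] with m hm x hx
  have hlim := tendsto_avgSeq_avgLimit hu (ha.mono (Metric.closedBall_subset_closedBall hx))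
  refine le_of_tendsto (hlim.sub_const (avgSeq u a m x)).abs ?_
  filter_upwards [eventually_ge_atTop m] with j hj using hm.abs_avgSeq_sub_le hj hx

lemma avgLimit_eq_of_norm_eq (hu : IsRecurrentlyDense u)
    (ha : ContinuousOn a (Metric.closedBall 0 ‖x‖)) {y : V} (hxy : ‖x‖ = ‖y‖) :
    avgLimit u a x = avgLimit u a y := by
  suffices key : ∀ {x y : V}, ContinuousOn a (Metric.closedBall 0 ‖x‖) → ‖x‖ = ‖y‖ →
      avgLimit u a x - avgLimit u a y ≤ 0 from
    le_antisymm (sub_nonpos.1 (key ha hxy)) (sub_nonpos.1 (key (hxy ▸ ha) hxy.symm))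
  intro x y ha hxy
  refine le_of_forall_pos_le_add fun ε hε => ?_
  rw [zero_add]
  refine le_of_tendsto
    ((tendsto_avgSeq_avgLimit hu ha).sub (tendsto_avgSeq_avgLimit hu (hxy ▸ ha))) ?_
  filter_upwards [eventually_sphericalOscLE_avgSeq hu (norm_nonneg x) ha hε] with m hm
    using hm x y hxy le_rfl

lemma apply_zero_le_avgLimit (hu : IsRecurrentlyDense u)
    (ha : ContinuousOn a (Metric.closedBall 0 ‖x‖))
    (hconv : ConvexOn ℝ (Metric.closedBall 0 ‖x‖) a) : a 0 ≤ avgLimit u a x := by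
  have midpoint : ∀ m y, ‖y‖ = ‖x‖ → 2 * a 0 ≤ avgSeq u a m y + avgSeq u a m (-y) := by
    intro m
    induction m with
    | zero =>
      intro y hy
      have := hconv.2 (x := y) (y := -y) (by simp [hy]) (by simp [hy])
        (one_half_pos (α := ℝ)).le one_half_pos.le (add_halves 1)
      rw [smul_neg, add_neg_cancel, smul_eq_mul, smul_eq_mul] at this
      simp only [avgSeq]
      linarith
    | succ m ih =>
      intro y hy
      have h_refl := ih (refl (u m) y) (by rwa [LinearIsometryEquiv.norm_map])
      simp only [avgSeq, map_neg]
      linarith [ih y hy]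
  have sum_le : 2 * a 0 ≤ avgLimit u a x + avgLimit u a (-x) :=
    ge_of_tendsto' ((tendsto_avgSeq_avgLimit hu ha).add
      (tendsto_avgSeq_avgLimit hu ((norm_neg x).symm ▸ ha))) fun m => midpoint m x rfl
  linarith [avgLimit_eq_of_norm_eq hu ha (norm_neg x).symm]

end Averages

/-! ### Domains of the support functions of iterated symmetrals -/

section SymIterSupport

variable {V : Type*} [NormedAddCommGroup V] [InnerProductSpace ℝ V]
  {K : Set (V × ℝ)} {u : ℕ → V} {r : ℝ}

lemma isLUB_symIter (hK : K.Nonempty) (hr : Metric.ball 0 r ⊆ suppDom K) (m : ℕ) :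
    ∀ y, ‖y‖ < r → IsLUB (aff y '' symIter u K m) (avgSeq u (supp K) m y) := by
  induction m with
  | zero => exact fun y hy => isLUB_supp hK (hr (by simpa using hy))
  | succ m ih =>
    exact fun y hy => isLUB_symSet (ih y hy) (ih _ (by rwa [LinearIsometryEquiv.norm_map]))

lemma supp_symIter (hK : K.Nonempty) (hr : Metric.ball 0 r ⊆ suppDom K) (m : ℕ) {y : V}
    (hy : ‖y‖ < r) : supp (symIter u K m) y = avgSeq u (supp K) m y :=
  (isLUB_symIter hK hr m y hy).csSup_eq ((nonempty_symIter hK m).image _)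

lemma continuousOn_supp [FiniteDimensional ℝ V] (hK : K.Nonempty) {ρ : ℝ} (hρ : ρ < r)
    (hr : Metric.ball 0 r ⊆ suppDom K) : ContinuousOn (supp K) (Metric.closedBall 0 ρ) :=
  (((convexOn_supp hK).subset hr (convex_ball _ _)).continuousOn Metric.isOpen_ball).mono
    (Metric.closedBall_subset_ball hρ)

end SymIterSupport

section Domains

variable {V : Type*} [NormedAddCommGroup V]

lemma norm_div_norm_smul [NormedSpace ℝ V] {ρ : ℝ} (hρ : 0 ≤ ρ) {x : V} (hx : x ≠ 0) :
    ‖(ρ / ‖x‖) • x‖ = ρ := by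
  rw [norm_smul, norm_div, norm_norm, Real.norm_of_nonneg hρ,
    div_mul_cancel₀ _ (norm_ne_zero_iff.2 hx)]

lemma exists_norm_eq_notMem_closure [NormedSpace ℝ V] {D : Set V} (hD : Convex ℝ D)
    (h₀ : D ∈ 𝓝 0) {ρ : ℝ} (hρ : ¬ Metric.ball 0 ρ ⊆ D) : ∃ w, ‖w‖ = ρ ∧ w ∉ closure D := by
  obtain ⟨z, hzρ, hz⟩ := Set.not_subset.1 hρ
  rw [mem_ball_zero_iff] at hzρ
  have hz0 : z ≠ 0 := fun h => hz (h ▸ mem_of_mem_nhds h₀)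
  have hz0' : 0 < ‖z‖ := norm_pos_iff.2 hz0
  have hρ0 : 0 < ρ := hz0'.trans hzρ
  refine ⟨(ρ / ‖z‖) • z, norm_div_norm_smul hρ0.le hz0, fun hw => hz (interior_subset ?_)⟩
  refine hD.openSegment_interior_closure_subset_interior (mem_interior_iff_mem_nhds.2 h₀) hw
    ⟨1 - ‖z‖ / ρ, ‖z‖ / ρ, sub_pos.2 ((div_lt_one hρ0).2 hzρ), div_pos hz0' hρ0,
      sub_add_cancel _ _, ?_⟩
  rw [smul_zero, zero_add, smul_smul, div_mul_div_cancel₀ hρ0.ne', div_self hz0'.ne', one_smul]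

lemma exists_radii_inv_sub_inv_le {X : Type*} [PseudoMetricSpace X] {c : X} {D : Set X}
    (h₀ : D ∈ 𝓝 c) {κ : ℝ} (hκ : 0 < κ) :
    ∃ ρ r, 0 < ρ ∧ ρ < r ∧ Metric.ball c r ⊆ D ∧
      (ρ⁻¹ ≤ κ ∨ ∃ ρ', 0 < ρ' ∧ ¬ Metric.ball c ρ' ⊆ D ∧ ρ⁻¹ - ρ'⁻¹ ≤ κ) := by
  by_cases hall : ∀ r, Metric.ball c r ⊆ D
  · exact ⟨κ⁻¹, κ⁻¹ + 1, inv_pos.2 hκ, lt_add_one _, hall _, Or.inl (inv_inv κ).le⟩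
  push Not at hall
  obtain ⟨R, hR⟩ := hall
  obtain ⟨ρ₀, hρ₀, hball₀⟩ := Metric.mem_nhds_iff.1 h₀
  have hbdd : BddAbove {r : ℝ | Metric.ball c r ⊆ D} := ⟨R, fun r hr => by
    by_contra! h
    exact hR ((Metric.ball_subset_ball h.le).trans hr)⟩
  obtain ⟨s, hs⟩ : ∃ s, IsLUB {r : ℝ | Metric.ball c r ⊆ D} s :=
    ⟨_, isLUB_csSup ⟨ρ₀, hball₀⟩ hbdd⟩
  have hs0 : 0 < s := hρ₀.trans_le (hs.1 hball₀)
  have hlim : Tendsto (fun η : ℝ => (s - η)⁻¹ - (s + η)⁻¹) (𝓝[>] 0) (𝓝 0) := by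
    have : ContinuousAt (fun η : ℝ => (s - η)⁻¹ - (s + η)⁻¹) 0 := by
      fun_prop (disch := simpa using hs0.ne')
    simpa [ContinuousAt] using this.mono_left nhdsWithin_le_nhds
  obtain ⟨η, hηκ, hη0, hηs⟩ := ((hlim.eventually_lt_const hκ).and
    (Ioo_mem_nhdsGT hs0)).exists
  obtain ⟨r, hr, hlt, -⟩ := hs.exists_between (sub_lt_self s hη0)
  exact ⟨s - η, r, sub_pos.2 hηs, hlt, hr, Or.inr ⟨s + η, by positivity,
    fun h => (lt_add_of_pos_right s hη0).not_ge (hs.1 h), hηκ.le⟩⟩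

variable [InnerProductSpace ℝ V] {K : Set (V × ℝ)} {u : ℕ → V}

lemma zero_mem_suppDom_symIter (hK : K.Nonempty) (h₀ : 0 ∈ suppDom K) (m : ℕ) :
    0 ∈ suppDom (symIter u K m) := by
  induction m with
  | zero => exact h₀
  | succ m ih =>
    exact (mem_suppDom_symSet (nonempty_symIter hK m)).2 ⟨ih, by rwa [map_zero]⟩

-- A point `w ∉ closure (suppDom K)` of norm `ρ` is, up to a small error, a reflection of every
-- point of norm `ρ`, which is therefore expelled from the domain.
lemma eventually_norm_le_of_mem_suppDom (hu : IsRecurrentlyDense u) (hK : K.Nonempty)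
    (h₀ : suppDom K ∈ 𝓝 0) {ρ : ℝ} (hρ0 : 0 < ρ) (hρ : ¬ Metric.ball 0 ρ ⊆ suppDom K) :
    ∀ᶠ m in atTop, ∀ y ∈ suppDom (symIter u K m), ‖y‖ ≤ ρ := by
  obtain ⟨w, hwρ, hw⟩ := exists_norm_eq_notMem_closure (convex_suppDom K) h₀ hρ
  obtain ⟨η, hη, hcap⟩ := Metric.nhds_basis_closedBall.mem_iff.1
    (isClosed_closure.isOpen_compl.mem_nhds hw)
  obtain ⟨L, hL⟩ := hu.exists_norm_refl_sub_le hη hρ0.le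
  obtain ⟨m, -, hm⟩ := hL 0
  filter_upwards [eventually_ge_atTop (m + L)] with j hj y hy
  by_contra! hyρ
  have hy0 : 0 < ‖y‖ := hρ0.trans hyρ
  set y' := (ρ / ‖y‖) • y
  have hy'ρ : ‖y'‖ = ρ := norm_div_norm_smul hρ0.le (norm_pos_iff.1 hy0)
  have hy'dom : y' ∈ suppDom (symIter u K j) :=
    (convex_suppDom _).smul_mem_of_zero_mem
      (zero_mem_suppDom_symIter hK (mem_of_mem_nhds h₀) j) hy
      ⟨by positivity, (div_le_one hy0).2 hyρ.le⟩
  by_cases hyw : y' = w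
  · exact hw (subset_closure (hyw ▸ antitone_suppDom_symIter hK j.zero_le hy'dom))
  · obtain ⟨i, hi, hclose⟩ := hm y' w (hy'ρ.trans hwρ.symm) hy'ρ.le hyw
    refine hcap (mem_closedBall_iff_norm.2 hclose) (subset_closure ?_)
    exact refl_mem_suppDom hK (antitone_suppDom_symIter hK (by omega) hy'dom)

lemma exists_radius_eventually_inv_sub_inv_le (hu : IsRecurrentlyDense u) (hK : K.Nonempty)
    (h₀ : suppDom K ∈ 𝓝 0) {κ : ℝ} (hκ : 0 < κ) :
    ∃ ρ r, 0 < ρ ∧ ρ < r ∧ Metric.ball 0 r ⊆ suppDom K ∧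
      ∀ᶠ m in atTop, ∀ y ∈ suppDom (symIter u K m), y ≠ 0 → ρ⁻¹ - ‖y‖⁻¹ ≤ κ := by
  obtain ⟨ρ, r, hρ, hρr, hr, hle | ⟨ρ', hρ'0, hρ', hle⟩⟩ :=
    exists_radii_inv_sub_inv_le h₀ hκ
  · exact ⟨ρ, r, hρ, hρr, hr, .of_forall fun m y _ _ =>
      (sub_le_self _ (inv_nonneg.2 (norm_nonneg y))).trans hle⟩
  · refine ⟨ρ, r, hρ, hρr, hr, ?_⟩
    filter_upwards [eventually_norm_le_of_mem_suppDom hu hK h₀ hρ'0 hρ'] with m hm y hy hy0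
    have := inv_anti₀ (norm_pos_iff.2 hy0) (hm y hy)
    linarith

end Domains

/-! ### Duality -/

section Duality

variable {V : Type*} [NormedAddCommGroup V] [InnerProductSpace ℝ V] {K : Set (V × ℝ)}

-- The hyperplane separating `K` from the strict hypograph of `φ` is not vertical, because the
-- hypograph projects onto all of `V`.
lemma exists_affine_between [CompleteSpace V] (hK : Convex ℝ K) (hne : K.Nonempty) {φ : V → ℝ}
    (hφ : ConcaveOn ℝ Set.univ φ) (hcont : Continuous φ) (hle : ∀ p ∈ K, φ p.1 ≤ p.2) :
    ∃ (y : V) (c : ℝ), (∀ p ∈ K, aff y p ≤ c) ∧ ∀ z, φ z ≤ ⟪y, z⟫_ℝ - c := by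
  obtain ⟨g, b, hg_lt, hg_ge⟩ := geometric_hahn_banach_open (s := {p : V × ℝ | p.2 < φ p.1})
    (by simpa using hφ.convex_strict_hypograph)
    (isOpen_lt continuous_snd (hcont.comp continuous_fst)) hK
    (Set.disjoint_left.2 fun p hp hpK => (hle p hpK).not_gt hp)
  set v := (InnerProductSpace.toDual ℝ V).symm (g.comp (ContinuousLinearMap.inl ℝ V ℝ)) with hv
  set s := g (0, 1)
  have g_apply : ∀ z t, g (z, t) = ⟪v, z⟫_ℝ + t * s := fun z t => by
    have : ((z, t) : V × ℝ) = (z, 0) + t • (0, 1) := by ext1 <;> simp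
    rw [this, map_add, map_smul, hv, InnerProductSpace.toDual_symm_apply]
    rfl
  have s_pos : 0 < s := by
    obtain ⟨p, hp⟩ := hne
    have below := hg_lt (p.1, φ p.1 - 1) (sub_one_lt (φ p.1))
    have above := hg_ge p hp
    rw [g_apply] at below above
    have hlt : 0 < p.2 - (φ p.1 - 1) := by linarith [hle p hp]
    exact (mul_pos_iff_of_pos_left hlt).1 (by linarith)
  refine ⟨-(s⁻¹ • v), -(s⁻¹ * b), fun p hp => ?_, fun z => le_of_forall_lt fun t ht => ?_⟩
  · have := mul_le_mul_of_nonneg_left (hg_ge p hp) (inv_pos.2 s_pos).le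
    rw [g_apply, mul_add, mul_left_comm, inv_mul_cancel₀ s_pos.ne', mul_one] at this
    rw [aff_apply, inner_neg_left, real_inner_smul_left]
    linarith
  · have := mul_lt_mul_of_pos_left (hg_lt (z, t) ht) (inv_pos.2 s_pos)
    rw [g_apply, mul_add, mul_left_comm, inv_mul_cancel₀ s_pos.ne', mul_one] at this
    rw [inner_neg_left, real_inner_smul_left]
    linarith

lemma inner_normalize_self (y : V) : ⟪y, NormedSpace.normalize y⟫_ℝ = ‖y‖ := by
  rcases eq_or_ne y 0 with rfl | hy
  · rw [inner_zero_left, norm_zero]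
  · rw [NormedSpace.normalize, real_inner_smul_right, real_inner_self_eq_norm_mul_norm,
      inv_mul_cancel_left₀ (norm_ne_zero_iff.2 hy)]

lemma norm_normalize_le_one (y : V) : ‖NormedSpace.normalize y‖ ≤ 1 := by
  rw [NormedSpace.normalize, norm_smul, norm_inv, norm_norm]
  exact inv_mul_le_one

-- Otherwise an affine function fits between `K` and `z ↦ T - M * max 0 (‖z - x‖ - δ / 2)` for a
-- large slope `M`, and the first hypothesis fails at its gradient.
lemma exists_mem_of_forall_lt_supp [CompleteSpace V] (hK : Convex ℝ K) (hne : K.Nonempty)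
    (h₀ : 0 ∈ suppDom K) {x : V} {δ T : ℝ} (hδ : 0 < δ)
    (h : ∀ y ∈ suppDom K, ⟪y, x⟫_ℝ - δ / 2 * ‖y‖ - T < supp K y) :
    ∃ p ∈ K, ‖p.1 - x‖ < δ ∧ p.2 < T := by
  by_contra! hfar
  set M := 2 * |T + supp K 0| / δ with hM
  have hM0 : 0 ≤ M := by positivity
  let φ : V → ℝ := fun z => T - M * max 0 (‖z - x‖ - δ / 2)
  have concave_φ : ConcaveOn ℝ Set.univ φ := by
    have convexOn_norm_sub : ConvexOn ℝ Set.univ fun z => ‖z - x‖ - δ / 2 := by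
      simp only [← dist_eq_norm]
      exact ConvexOn.sub (convexOn_univ_dist x) (concaveOn_const (δ / 2) convex_univ)
    exact (concaveOn_const T convex_univ).sub
      (((convexOn_const 0 convex_univ).sup convexOn_norm_sub).smul hM0)
  have φ_le : ∀ p ∈ K, φ p.1 ≤ p.2 := fun p hp => by
    rcases lt_or_ge ‖p.1 - x‖ δ with hlt | hge
    · exact (sub_le_self T (by positivity)).trans (hfar p hp hlt)
    · have neg_snd_le : -p.2 ≤ supp K 0 := by simpa [aff_apply] using aff_le_supp h₀ hp
      calc φ p.1 ≤ T - M * (δ / 2) := by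
            refine sub_le_sub_left (mul_le_mul_of_nonneg_left (le_max_of_le_right ?_) hM0) T
            linarith
        _ = T - |T + supp K 0| := by rw [hM]; field_simp
        _ ≤ p.2 := by linarith [le_abs_self (T + supp K 0)]
  obtain ⟨y, c, hy, hc⟩ := exists_affine_between hK hne concave_φ (by fun_prop) φ_le
  set z := x - (δ / 2) • NormedSpace.normalize y with hz
  have φ_z : φ z = T := by
    have : ‖z - x‖ ≤ δ / 2 := by
      rw [hz, sub_sub_cancel_left, norm_neg, norm_smul, Real.norm_of_nonneg (half_pos hδ).le]
      exact mul_le_of_le_one_right (half_pos hδ).le (norm_normalize_le_one y)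
    simp only [φ, max_eq_left (sub_nonpos.2 this), mul_zero, sub_zero]
  have inner_z : ⟪y, z⟫_ℝ = ⟪y, x⟫_ℝ - δ / 2 * ‖y‖ := by
    rw [hz, inner_sub_right, real_inner_smul_right, inner_normalize_self]
  refine (h y (mem_suppDom_iff.2 ⟨c, hy⟩)).not_ge ((supp_le hne hy).trans ?_)
  linarith [hc z]

end Duality

section Recovery

variable {V : Type*} [NormedAddCommGroup V] [InnerProductSpace ℝ V] {K : Set (V × ℝ)} {x : V}

-- Beyond radius `ρ` the bound is propagated along rays from the origin by convexity of `supp K`.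
lemma lt_supp_of_forall_norm_le (hK : K.Nonempty) (h₀ : 0 ∈ suppDom K) {v δ ε κ η ρ : ℝ}
    (hρ : 0 < ρ) (hδ : 0 ≤ δ) (hε : 0 < ε) (hηε : η < ε)
    (hv : 0 ≤ v + supp K 0) (hη : η ≤ ρ * (δ - κ * (v + supp K 0)))
    (hnear : ∀ y ∈ suppDom K, ‖y‖ ≤ ρ → ⟪y, x⟫_ℝ - v - η ≤ supp K y)
    (hdom : ∀ y ∈ suppDom K, y ≠ 0 → ρ⁻¹ - ‖y‖⁻¹ ≤ κ) {y : V} (hy : y ∈ suppDom K) :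
    ⟪y, x⟫_ℝ - δ * ‖y‖ - (v + ε) < supp K y := by
  rcases le_or_gt ‖y‖ ρ with hyρ | hyρ
  · linarith [hnear y hy hyρ, mul_nonneg hδ (norm_nonneg y)]
  have hy0 : 0 < ‖y‖ := hρ.trans hyρ
  set l := ρ / ‖y‖ with hl
  have l_pos : 0 < l := div_pos hρ hy0
  have l_le : l ≤ 1 := (div_le_one hy0).2 hyρ.le
  have l_mul_norm : l * ‖y‖ = ρ := div_mul_cancel₀ _ hy0.ne'
  have smul_mem : l • y ∈ suppDom K := by
    simpa using convex_suppDom K hy h₀ l_pos.le (sub_nonneg.2 l_le) (add_sub_cancel l 1)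
  have near := hnear _ smul_mem (norm_div_norm_smul hρ.le (norm_pos_iff.1 hy0)).le
  have chord := (convexOn_supp hK).2 hy h₀ l_pos.le (sub_nonneg.2 l_le) (add_sub_cancel l 1)
  rw [smul_zero, add_zero, smul_eq_mul, smul_eq_mul] at chord
  rw [real_inner_smul_left] at near
  have one_sub_l_le : 1 - l ≤ ρ * κ := by
    calc 1 - l = ρ * (ρ⁻¹ - ‖y‖⁻¹) := by rw [hl, mul_sub, mul_inv_cancel₀ hρ.ne', div_eq_mul_inv]
      _ ≤ ρ * κ := mul_le_mul_of_nonneg_left (hdom y hy (norm_pos_iff.1 hy0)) hρ.le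
  have hQ := mul_le_mul_of_nonneg_right one_sub_l_le hv
  refine lt_of_mul_lt_mul_left ?_ l_pos.le
  calc l * (⟪y, x⟫_ℝ - δ * ‖y‖ - (v + ε)) = l * ⟪y, x⟫_ℝ - l * v - δ * ρ - l * ε := by
        rw [← l_mul_norm]; ring
    _ < l * ⟪y, x⟫_ℝ - l * v - δ * ρ := sub_lt_self _ (mul_pos l_pos hε)
    _ ≤ l * supp K y := by linarith

/-- The union of the open balls centred at the origin on which the support function of `K` is
finite; it is the largest rotation-invariant set on which the averages converge. -/
def centredDom (K : Set (V × ℝ)) : Set V := {y | ∃ r, ‖y‖ < r ∧ Metric.ball 0 r ⊆ suppDom K}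

lemma mem_centredDom_of_norm_eq {y z : V} (hy : y ∈ centredDom K) (hyz : ‖y‖ = ‖z‖) :
    z ∈ centredDom K := by
  obtain ⟨r, hyr, hr⟩ := hy
  exact ⟨r, hyz ▸ hyr, hr⟩

lemma zero_mem_centredDom (h₀ : suppDom K ∈ 𝓝 0) : 0 ∈ centredDom K := by
  obtain ⟨r, hr, hball⟩ := Metric.mem_nhds_iff.1 h₀
  exact ⟨r, norm_zero.trans_lt hr, hball⟩

variable [FiniteDimensional ℝ V] {u : ℕ → V}

lemma eventually_exists_mem_symIter (hu : IsRecurrentlyDense u) (hK : K.Nonempty)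
    (hconv : Convex ℝ K) (h₀ : suppDom K ∈ 𝓝 0) {v : ℝ}
    (hv : ∀ y ∈ centredDom K, ⟪y, x⟫_ℝ - avgLimit u (supp K) y ≤ v) {δ ε : ℝ} (hδ : 0 < δ)
    (hε : 0 < ε) : ∀ᶠ m in atTop, ∃ p ∈ symIter u K m, ‖p.1 - x‖ < δ ∧ p.2 < v + ε := by
  set Q := v + supp K 0 with hQ
  have Q_nonneg : 0 ≤ Q := by
    have := hv 0 (zero_mem_centredDom h₀)
    rw [avgLimit_zero, inner_zero_left] at this
    linarith
  set κ := δ / 2 / (Q + 1) with hκ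
  have κ_pos : 0 < κ := by positivity
  have sub_κ_mul : δ / 2 - κ * Q = κ := by rw [hκ]; field_simp; ring
  obtain ⟨ρ, r, hρ, hρr, hr, hdom⟩ := exists_radius_eventually_inv_sub_inv_le hu hK h₀ κ_pos
  filter_upwards [hdom, eventually_abs_avgLimit_sub_le hu hρ.le (continuousOn_supp hK hρr hr)
    (lt_min (half_pos hε) (mul_pos hρ κ_pos))] with m hdom_m hm
  have supp_zero : supp (symIter u K m) 0 = supp K 0 := by
    rw [supp_symIter hK hr m (norm_zero.trans_lt (hρ.trans hρr)), avgSeq_zero_apply]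
  have h₀m := zero_mem_suppDom_symIter (u := u) hK (mem_of_mem_nhds h₀) m
  have hne := nonempty_symIter (u := u) hK m
  refine exists_mem_of_forall_lt_supp (convex_symIter hconv m) hne h₀m hδ fun y hy =>
    lt_supp_of_forall_norm_le (κ := κ) hne h₀m hρ (half_pos hδ).le hε
      ((min_le_left _ (ρ * κ)).trans_lt (half_lt_self hε)) (supp_zero ▸ Q_nonneg) ?_ ?_ hdom_m hy
  · rw [supp_zero, ← hQ, sub_κ_mul]
    exact min_le_right _ _
  · intro z _ hz
    rw [supp_symIter hK hr m (hz.trans_lt hρr)]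
    linarith [hv z ⟨r, hz.trans_lt hρr, hr⟩, (abs_le.1 (hm z hz)).2]

end Recovery

/-! ### Coercive convex functions -/

section LinearGrowth

variable {V : Type*} [NormedAddCommGroup V] [InnerProductSpace ℝ V] {K : Set (V × ℝ)}

lemma norm_div_le_of_forall_norm_eq (hK : Convex ℝ K) {p₀ : V × ℝ} (h₀ : p₀ ∈ K) {R : ℝ}
    (hR : 0 < R) (hfar : ∀ p ∈ K, ‖p.1 - p₀.1‖ = R → p₀.2 + 1 ≤ p.2) {p : V × ℝ} (hp : p ∈ K)
    (hpR : R ≤ ‖p.1 - p₀.1‖) : ‖p.1 - p₀.1‖ / R ≤ p.2 - p₀.2 := by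
  have norm_pos : 0 < ‖p.1 - p₀.1‖ := hR.trans_le hpR
  set l := R / ‖p.1 - p₀.1‖
  have hl0 : 0 < l := div_pos hR norm_pos
  have mem : l • p + (1 - l) • p₀ ∈ K :=
    hK hp h₀ hl0.le (sub_nonneg.2 ((div_le_one norm_pos).2 hpR)) (add_sub_cancel l 1)
  have norm_eq : ‖(l • p + (1 - l) • p₀).1 - p₀.1‖ = R := by
    have : (l • p + (1 - l) • p₀).1 - p₀.1 = l • (p.1 - p₀.1) := by
      simp only [Prod.fst_add, Prod.smul_fst]
      module
    rw [this, norm_div_norm_smul hR.le (norm_pos_iff.1 norm_pos)]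
  have snd_le : p₀.2 + 1 ≤ l * p.2 + (1 - l) * p₀.2 := hfar _ mem norm_eq
  rw [← inv_div, inv_le_iff_one_le_mul₀' hl0]
  linarith

lemma suppDom_mem_nhds_zero {α β : ℝ} (hα : 0 < α) (h : ∀ p ∈ K, α * ‖p.1‖ ≤ p.2 + β) :
    suppDom K ∈ 𝓝 0 := by
  filter_upwards [Metric.ball_mem_nhds 0 hα] with y hy
  refine mem_suppDom_iff.2 ⟨β, fun p hp => ?_⟩
  rw [aff_apply, sub_le_iff_le_add']
  calc ⟪y, p.1⟫_ℝ ≤ ‖y‖ * ‖p.1‖ := real_inner_le_norm y p.1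
    _ ≤ α * ‖p.1‖ := by
        gcongr
        exact (mem_ball_zero_iff.1 hy).le
    _ ≤ p.2 + β := h p hp

end LinearGrowth

lemma exists_coe_le_of_isCompact {X : Type*} [TopologicalSpace X] {ψ : X → EReal}
    (hψ : LowerSemicontinuous ψ) (hbot : ∀ x, ψ x ≠ ⊥) {s : Set X} (hs : IsCompact s) :
    ∃ B : ℝ, ∀ x ∈ s, (B : EReal) ≤ ψ x := by
  rcases s.eq_empty_or_nonempty with rfl | hne
  · exact ⟨0, fun _ hx => hx.elim⟩
  obtain ⟨z, -, hz⟩ := (hψ.lowerSemicontinuousOn s).exists_isMinOn hne hs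
  obtain ⟨B, -, hB⟩ := EReal.lt_iff_exists_real_btwn.1 (bot_lt_iff_ne_bot.2 (hbot z))
  exact ⟨B, fun x hx => hB.le.trans (hz hx)⟩

section Coercive

variable {n : ℕ} {ψ : E n → EReal} {f : E n → ℝ≥0∞}

lemma IsLCc.isConvC_base (hf : IsLCc f) : IsConvC (base f) := by
  obtain ⟨-, ψ, hψ, hfψ⟩ := hf
  rwa [funext hfψ, base_exp_neg]

lemma IsLCc.base_ne_bot (hf : IsLCc f) (x : E n) : base f x ≠ ⊥ := by
  rw [base, Ne, EReal.neg_eq_bot_iff, ENNReal.log_eq_top_iff]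
  exact hf.1 x

lemma IsConvC.nonempty_strictEpi (hψ : IsConvC ψ) : (strictEpi ψ).Nonempty := by
  obtain ⟨x, hx⟩ := hψ.proper
  obtain ⟨t, ht, -⟩ := EReal.lt_iff_exists_real_btwn.1 hx
  exact ⟨(x, t), ht⟩

lemma IsConvC.exists_lt_of_le_norm_sub (hψ : IsConvC ψ) (x₀ : E n) (T : ℝ) :
    ∃ R > 0, ∀ x, R ≤ ‖x - x₀‖ → (T : EReal) < ψ x := by
  obtain ⟨R, -, hR⟩ := (Metric.hasBasis_cobounded_compl_closedBall x₀).eventually_iff.1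
    (hψ.coercive.eventually_const_lt (EReal.coe_lt_top T))
  refine ⟨max R 0 + 1, by positivity, fun x hx => hR ?_⟩
  rw [Set.mem_compl_iff, Metric.mem_closedBall, dist_eq_norm, not_le]
  linarith [le_max_left R 0]

lemma IsConvC.exists_mul_norm_le (hψ : IsConvC ψ) (hbot : ∀ x, ψ x ≠ ⊥) :
    ∃ α > 0, ∃ β, ∀ p ∈ epi ψ, α * ‖p.1‖ ≤ p.2 + β := by
  obtain ⟨p₀, h₀⟩ := hψ.nonempty_strictEpi
  obtain ⟨R, hR, hfar⟩ := hψ.exists_lt_of_le_norm_sub p₀.1 (p₀.2 + 1)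
  obtain ⟨B, hB⟩ :=
    exists_coe_le_of_isCompact hψ.lsc hbot (isCompact_closedBall p₀.1 R)
  have far : ∀ p ∈ epi ψ, ‖p.1 - p₀.1‖ = R → p₀.2 + 1 ≤ p.2 := fun p hp hpR =>
    EReal.coe_le_coe_iff.1 ((hfar p.1 hpR.ge).le.trans hp)
  refine ⟨R⁻¹, inv_pos.2 hR, R⁻¹ * ‖p₀.1‖ + max (1 - B) (-p₀.2), fun p hp => ?_⟩
  have triangle : R⁻¹ * ‖p.1‖ ≤ ‖p.1 - p₀.1‖ / R + R⁻¹ * ‖p₀.1‖ := by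
    rw [div_eq_inv_mul, ← mul_add]
    gcongr
    exact norm_le_norm_sub_add p.1 p₀.1
  rcases le_total ‖p.1 - p₀.1‖ R with hpR | hpR
  · have B_le : B ≤ p.2 :=
      EReal.coe_le_coe_iff.1 ((hB p.1 (mem_closedBall_iff_norm.2 hpR)).trans hp)
    linarith [(div_le_one hR).2 hpR, le_max_left (1 - B) (-p₀.2)]
  · linarith [le_max_right (1 - B) (-p₀.2), norm_div_le_of_forall_norm_eq hψ.convex
      (strictEpi_subset_epi ψ h₀) hR far hp hpR]

lemma IsConvC.suppDom_strictEpi_mem_nhds_zero (hψ : IsConvC ψ) (hbot : ∀ x, ψ x ≠ ⊥) :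
    suppDom (strictEpi ψ) ∈ 𝓝 0 := by
  obtain ⟨α, hα, β, h⟩ := hψ.exists_mul_norm_le hbot
  exact suppDom_mem_nhds_zero hα fun p hp => h p (strictEpi_subset_epi ψ hp)

end Coercive

/-! ### Conjugates of functions given on a set -/

section ConjOn

variable {V : Type*} [NormedAddCommGroup V] [InnerProductSpace ℝ V] {U : Set V} {b : V → ℝ}

/-- The convex conjugate of the function equal to `b` on `U` and to `+∞` elsewhere. -/
noncomputable def conjOn (U : Set V) (b : V → ℝ) (x : V) : EReal :=
  ⨆ y ∈ U, ((⟪y, x⟫_ℝ - b y : ℝ) : EReal)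

lemma conjOn_le_coe_iff {x : V} {t : ℝ} :
    conjOn U b x ≤ (t : EReal) ↔ ∀ y ∈ U, ⟪y, x⟫_ℝ - b y ≤ t := by
  simp only [conjOn, iSup_le_iff, EReal.coe_le_coe_iff]

lemma le_conjOn (x : V) {y : V} (hy : y ∈ U) :
    ((⟪y, x⟫_ℝ - b y : ℝ) : EReal) ≤ conjOn U b x :=
  le_iSup₂ (f := fun y (_ : y ∈ U) => ((⟪y, x⟫_ℝ - b y : ℝ) : EReal)) y hy

lemma conjOn_ne_bot (hU : U.Nonempty) (x : V) : conjOn U b x ≠ ⊥ :=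
  ne_bot_of_le_ne_bot (EReal.coe_ne_bot _) (le_conjOn x hU.some_mem)

lemma lowerSemicontinuous_conjOn (U : Set V) (b : V → ℝ) : LowerSemicontinuous (conjOn U b) :=
  lowerSemicontinuous_iSup fun y => lowerSemicontinuous_iSup fun _ =>
    (continuous_coe_real_ereal.comp (by fun_prop)).lowerSemicontinuous

lemma tendsto_conjOn_cobounded {ρ C : ℝ} (hρ : 0 < ρ) (hC : ∀ y, ‖y‖ = ρ → y ∈ U ∧ b y ≤ C) :
    Tendsto (conjOn U b) (Bornology.cobounded V) (𝓝 ⊤) := by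
  refine EReal.tendsto_nhds_top_iff_real.2 fun M => ?_
  filter_upwards [(tendsto_norm_cobounded_atTop (E := V)).eventually_gt_atTop
    (max 0 ((M + C) / ρ))] with x hx
  have hx0 : x ≠ 0 := norm_pos_iff.1 ((le_max_left _ _).trans_lt hx)
  have lt_mul : M + C < ‖x‖ * ρ := (div_lt_iff₀ hρ).1 ((le_max_right _ _).trans_lt hx)
  obtain ⟨mem, b_le⟩ := hC ((ρ / ‖x‖) • x) (norm_div_norm_smul hρ.le hx0)
  refine (EReal.coe_lt_coe_iff.2 ?_).trans_le (le_conjOn x mem)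
  have inner_eq : ⟪(ρ / ‖x‖) • x, x⟫_ℝ = ‖x‖ * ρ := by
    rw [real_inner_smul_left, real_inner_self_eq_norm_sq]
    field_simp
  linarith

lemma conjOn_map_isometry (hU : ∀ y ∈ U, ∀ z, ‖y‖ = ‖z‖ → z ∈ U ∧ b y = b z) (T : V ≃ₗᵢ[ℝ] V)
    (x : V) : conjOn U b (T x) = conjOn U b x := by
  suffices key : ∀ (T : V ≃ₗᵢ[ℝ] V) x, conjOn U b (T x) ≤ conjOn U b x from
    (key T x).antisymm (by simpa using key T.symm (T x))
  refine fun T x => iSup₂_le fun y hy => ?_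
  obtain ⟨mem, b_eq⟩ := hU y hy (T.symm y) (T.symm.norm_map y).symm
  have inner_eq : ⟪y, T x⟫_ℝ = ⟪T.symm y, x⟫_ℝ := by
    rw [← T.inner_map_map (T.symm y), T.apply_symm_apply]
  rw [inner_eq, b_eq]
  exact le_conjOn x mem

end ConjOn

section IsConvC

variable {n : ℕ} {U : Set (E n)} {b : E n → ℝ}

lemma convex_epi_conjOn (U : Set (E n)) (b : E n → ℝ) : Convex ℝ (epi (conjOn U b)) := by
  have epi_eq : epi (conjOn U b) = ⋂ y ∈ U, {p | aff y p ≤ b y} := by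
    ext p
    simp only [epi, Set.mem_ofPred_eq, conjOn_le_coe_iff, Set.mem_iInter, aff_apply,
      sub_le_iff_le_add, add_comm]
  rw [epi_eq]
  exact convex_iInter₂ fun y _ => convex_halfSpace_le (aff y).isLinear (b y)

lemma isConvC_conjOn {ρ C c : ℝ} (hρ : 0 < ρ) (hC : ∀ y, ‖y‖ = ρ → y ∈ U ∧ b y ≤ C)
    (hc : ∀ y ∈ U, c ≤ b y) : IsConvC (conjOn U b) where
  convex := convex_epi_conjOn U b
  coercive := tendsto_conjOn_cobounded hρ hC
  proper := by
    refine ⟨0, ((conjOn_le_coe_iff (t := -c)).2 fun y hy => ?_).trans_lt (EReal.coe_lt_top _)⟩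
    rw [inner_zero_right]
    linarith [hc y hy]
  lsc := lowerSemicontinuous_conjOn U b

end IsConvC

/-! ### Existence of hypo-symmetrizations -/

lemma exists_seq_tendsto_of_eventually_inter_nonempty {X : Type*} {l : Filter X}
    [l.IsCountablyGenerated] {S : ℕ → Set X}
    (h : ∀ U ∈ l, ∀ᶠ j in atTop, (U ∩ S j).Nonempty) :
    ∃ s : ℕ → X, Tendsto s atTop l ∧ ∀ᶠ j in atTop, s j ∈ S j := by
  classical
  obtain ⟨U, hU⟩ := l.exists_antitone_basis
  obtain ⟨-, x₀, -⟩ := (h Set.univ univ_mem).exists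
  let k : ℕ → ℕ := fun j => Nat.findGreatest (fun i => (U i ∩ S j).Nonempty) j
  let s : ℕ → X := fun j => if hj : (U (k j) ∩ S j).Nonempty then hj.some else x₀
  have mem : ∀ i, ∀ᶠ j in atTop, s j ∈ U i ∩ S j := fun i => by
    filter_upwards [h (U i) (hU.mem i), eventually_ge_atTop i] with j hj hij
    have hk : (U (k j) ∩ S j).Nonempty :=
      Nat.findGreatest_spec (P := fun i => (U i ∩ S j).Nonempty) hij hj
    simp only [s, dif_pos hk]
    exact ⟨hU.antitone (Nat.le_findGreatest hij hj) hk.some_mem.1, hk.some_mem.2⟩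
  exact ⟨s, hU.tendsto_right_iff.2 fun i _ => (mem i).mono fun _ hj => hj.1,
    (mem 0).mono fun _ hj => hj.2⟩

section AvgLimitSupp

variable {V : Type*} [NormedAddCommGroup V] [InnerProductSpace ℝ V] [FiniteDimensional ℝ V]
  {K : Set (V × ℝ)} {u : ℕ → V} {y : V}

lemma continuousOn_supp_of_mem_centredDom (hK : K.Nonempty) (hy : y ∈ centredDom K) :
    ContinuousOn (supp K) (Metric.closedBall 0 ‖y‖) :=
  let ⟨_, hyr, hr⟩ := hy
  continuousOn_supp hK hyr hr

lemma supp_zero_le_avgLimit (hu : IsRecurrentlyDense u) (hK : K.Nonempty)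
    (hy : y ∈ centredDom K) : supp K 0 ≤ avgLimit u (supp K) y := by
  refine apply_zero_le_avgLimit hu (continuousOn_supp_of_mem_centredDom hK hy) ?_
  obtain ⟨r, hyr, hr⟩ := hy
  exact (convexOn_supp hK).subset ((Metric.closedBall_subset_ball hyr).trans hr)
    (convex_closedBall _ _)

end AvgLimitSupp

section Limit

variable {n : ℕ} {u : ℕ → E n} {f : E n → ℝ≥0∞}

/-- The base function of the hypo-limit of the Minkowski symmetrals of `f` in the directions `u`:
the conjugate of the limit of the averaged support functions. -/
noncomputable def limitBase (u : ℕ → E n) (f : E n → ℝ≥0∞) : E n → EReal :=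
  conjOn (centredDom (strictEpi (base f))) (avgLimit u (supp (strictEpi (base f))))

lemma le_base_iterSym (hK : (strictEpi (base f)).Nonempty) {y : E n}
    (hy : y ∈ centredDom (strictEpi (base f))) (m : ℕ) (z : E n) :
    ((⟪y, z⟫_ℝ - avgSeq u (supp (strictEpi (base f))) m y : ℝ) : EReal) ≤
      base (iterSym u f m) z := by
  obtain ⟨r, hyr, hr⟩ := hy
  refine EReal.le_of_forall_lt_iff_le.1 fun t ht => EReal.coe_le_coe_iff.2 ?_
  have mem : (z, t) ∈ symIter u (strictEpi (base f)) m :=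
    strictEpi_base_iterSym u f m ▸ ht
  have := (isLUB_symIter (u := u) hK hr m y hyr).1 ⟨_, mem, rfl⟩
  rw [aff_apply] at this
  linarith

lemma limitBase_le_liminf (hu : IsRecurrentlyDense u) (hK : (strictEpi (base f)).Nonempty)
    {x : E n} {s : ℕ → E n} (hs : Tendsto s atTop (𝓝 x)) :
    limitBase u f x ≤ liminf (fun j => base (iterSym u f j) (s j)) atTop := by
  refine iSup₂_le fun y hy => ?_
  have hlim : Tendsto (fun j => ((⟪y, s j⟫_ℝ - avgSeq u (supp (strictEpi (base f))) j y : ℝ) :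
      EReal)) atTop (𝓝 ((⟪y, x⟫_ℝ - avgLimit u (supp (strictEpi (base f))) y : ℝ) : EReal)) :=
    EReal.tendsto_coe.2 ((tendsto_const_nhds.inner hs).sub
      (tendsto_avgSeq_avgLimit hu (continuousOn_supp_of_mem_centredDom hK hy)))
  rw [← hlim.liminf_eq]
  exact liminf_le_liminf (Eventually.of_forall fun j => le_base_iterSym hK hy j (s j))

lemma exists_seq_limsup_le_limitBase (hu : IsRecurrentlyDense u) (hf : IsLCc f) (x : E n) :
    ∃ s : ℕ → E n, Tendsto s atTop (𝓝 x) ∧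
      limsup (fun j => base (iterSym u f j) (s j)) atTop ≤ limitBase u f x := by
  have hψ := hf.isConvC_base
  have h₀ := hψ.suppDom_strictEpi_mem_nhds_zero hf.base_ne_bot
  rcases eq_or_ne (limitBase u f x) ⊤ with htop | htop
  · exact ⟨fun _ => x, tendsto_const_nhds, htop ▸ le_top⟩
  obtain ⟨v, hv⟩ : ∃ v : ℝ, (v : EReal) = limitBase u f x :=
    ⟨_, EReal.coe_toReal htop (conjOn_ne_bot ⟨0, zero_mem_centredDom h₀⟩ x)⟩
  obtain ⟨p, hp, p_mem⟩ := exists_seq_tendsto_of_eventually_inter_nonempty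
    (l := 𝓝 (x, v)) (S := fun j => epi (base (iterSym u f j))) fun U hU => by
      obtain ⟨ε, hε, hball⟩ := Metric.mem_nhds_iff.1 hU
      filter_upwards [eventually_exists_mem_symIter hu hψ.nonempty_strictEpi
        (convex_strictEpi hψ.convex) h₀ (conjOn_le_coe_iff.1 hv.ge) hε hε] with j hj
      obtain ⟨q, hq, hqx, hqv⟩ := hj
      rw [← strictEpi_base_iterSym] at hq
      refine ⟨(q.1, max q.2 v), hball ?_,
        (strictEpi_subset_epi _ hq).trans (EReal.coe_le_coe_iff.2 (le_max_left _ _))⟩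
      have dist_snd : dist (max q.2 v) v < ε := by
        rw [Real.dist_eq, abs_of_nonneg (sub_nonneg.2 (le_max_right _ _)), sub_lt_iff_lt_add']
        exact max_lt hqv (lt_add_of_pos_right v hε)
      exact max_lt (by rwa [dist_eq_norm]) dist_snd
  refine ⟨fun j => (p j).1, (continuous_fst.tendsto _).comp hp, ?_⟩
  rw [← hv, ← (EReal.tendsto_coe.2 ((continuous_snd.tendsto _).comp hp)).limsup_eq]
  exact limsup_le_limsup p_mem

lemma epiConverges_limitBase (hu : IsRecurrentlyDense u) (hf : IsLCc f) :
    EpiConverges (fun j => base (iterSym u f j)) (limitBase u f) := fun x => by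
  have hK := hf.isConvC_base.nonempty_strictEpi
  obtain ⟨s, hs, hle⟩ := exists_seq_limsup_le_limitBase hu hf x
  exact ⟨fun s hs => limitBase_le_liminf hu hK hs,
    s, hs, tendsto_of_le_liminf_of_limsup_le (limitBase_le_liminf hu hK hs) hle⟩

lemma isConvC_limitBase (hn : 1 ≤ n) (hu : IsRecurrentlyDense u) (hf : IsLCc f) :
    IsConvC (limitBase u f) := by
  have : Nonempty (Fin n) := ⟨⟨0, hn⟩⟩
  have hK := hf.isConvC_base.nonempty_strictEpi
  obtain ⟨r, hr, hball⟩ := Metric.mem_nhds_iff.1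
    (hf.isConvC_base.suppDom_strictEpi_mem_nhds_zero hf.base_ne_bot)
  obtain ⟨z, hz⟩ := (NormedSpace.sphere_nonempty (x := (0 : E n))).2 (half_pos hr).le
  have norm_z : ‖z‖ = r / 2 := mem_sphere_zero_iff_norm.1 hz
  have mem : ∀ y : E n, ‖y‖ = r / 2 → y ∈ centredDom (strictEpi (base f)) := fun y hy =>
    ⟨r, hy.trans_lt (half_lt_self hr), hball⟩
  exact isConvC_conjOn (half_pos hr)
    (fun y hy => ⟨mem y hy, (avgLimit_eq_of_norm_eq hu
      (continuousOn_supp_of_mem_centredDom hK (mem y hy)) (hy.trans norm_z.symm)).le⟩)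
    fun y hy => supp_zero_le_avgLimit hu hK hy

lemma limitBase_map_isometry (hu : IsRecurrentlyDense u) (hK : (strictEpi (base f)).Nonempty)
    (T : E n ≃ₗᵢ[ℝ] E n) (x : E n) : limitBase u f (T x) = limitBase u f x :=
  conjOn_map_isometry (fun _ hy _ hyz => ⟨mem_centredDom_of_norm_eq hy hyz,
    avgLimit_eq_of_norm_eq hu (continuousOn_supp_of_mem_centredDom hK hy) hyz⟩) T x

lemma isHypoSymmetrization_exp_neg_limitBase (hn : 1 ≤ n) (hu : IsRecurrentlyDense u)
    (hf : IsLCc f) : IsHypoSymmetrization f fun x => EReal.exp (-limitBase u f x) where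
  mem := by
    refine ⟨fun x => ?_, _, isConvC_limitBase hn hu hf, fun _ => rfl⟩
    rw [Ne, EReal.exp_eq_top_iff, EReal.neg_eq_top_iff]
    exact conjOn_ne_bot ⟨0, zero_mem_centredDom
      (hf.isConvC_base.suppDom_strictEpi_mem_nhds_zero hf.base_ne_bot)⟩ x
  rotation_invariant T x := by
    simp only [limitBase_map_isometry hu hf.isConvC_base.nonempty_strictEpi]
  limit := by
    refine ⟨u, hu.norm_eq_one, ?_⟩
    rw [HypoConverges, base_exp_neg]
    exact epiConverges_limitBase hu hf

lemma exists_isHypoSymmetrization (hn : 1 ≤ n) (hf : IsLCc f) :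
    ∃ g, IsHypoSymmetrization f g := by
  have : Nonempty (Fin n) := ⟨⟨0, hn⟩⟩
  obtain ⟨u, hu⟩ := exists_isRecurrentlyDense (E n)
  exact ⟨_, isHypoSymmetrization_exp_neg_limitBase hn hu hf⟩

end Limit

end HypoSym

theorem theorem5p2_general (n N : ℕ) (hn : 1 ≤ n)
    (f : HypoSym.E n → ENNReal) (hf : HypoSym.IsLCc f) :
    (∃ fsym : HypoSym.E n → ENNReal, HypoSym.IsHypoSymmetrization f fsym) ∧
    ∀ fsym : HypoSym.E n → ENNReal, HypoSym.IsHypoSymmetrization f fsym →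
      HypoSym.G N f ≥ HypoSym.G N fsym := by
  refine ⟨HypoSym.exists_isHypoSymmetrization hn hf, fun fsym hsym => ?_⟩
  obtain ⟨u, -, hu⟩ := hsym.limit
  exact HypoSym.G_le_of_hypoConverges_iterSym hn N hu

theorem theorem5p2 (n N : ℕ) (hn : 1 ≤ n) (hN : n + 2 ≤ N)
    (f : HypoSym.E n → ENNReal) (hf : HypoSym.IsLCc f) :
    (∃ fsym : HypoSym.E n → ENNReal, HypoSym.IsHypoSymmetrization f fsym) ∧
    ∀ fsym : HypoSym.E n → ENNReal, HypoSym.IsHypoSymmetrization f fsym →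
      HypoSym.G N f ≥ HypoSym.G N fsym :=
  theorem5p2_general n N hn f hf
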